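/- Let $R$ be the root system of type $D_4$ with simple roots $\alpha_1,\alpha_2,\alpha_3,\alpha_4$ ($\alpha_2$ being the one joined to the other three), and let $\Gamma=\{\gamma\in R\mid\langle\gamma,\omega_1\rangle=1\}=\{\underline2,\underline3,\underline4,4,3,2\}$ be the set of colors, where $$\underline2=\alpha_1,\quad \underline3=\alpha_1+\alpha_2,\quad \underline4=\alpha_1+\alpha_2+\alpha_3,\quad 4=\alpha_1+\alpha_2+\alpha_4,\quad 3=\alpha_1+\alpha_2+\alpha_3+\alpha_4,\quad 2=\alpha_1+2\alpha_2+\alpha_3+\alpha_4,$$ ordered by $2>3>4>\underline4>\underline3>\underline2$. Consider monomials $\underline x=x_{\gamma_n}(-r_n)\cdots x_{\gamma_1}(-r_1)$ ($n\ge 0$) in commuting variables $x_\gamma(-r)$, $\gamma\in\Gamma$, $r\in\{1,2,\dots\}$, with factors sorted ascendingly from left to right with respect to the order in which $x_\gamma(-r)<x_{\gamma'}(-r')$ if $-r<-r'$, or $r=r'$ and $\gamma<\gamma'$. Set $w(\underline x)=\gamma_1+\dots+\gamma_n$ and $d(\underline x)=r_1+\dots+r_n$. Let $E(\gamma',\gamma)=0$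 if $(\gamma',\gamma)=(\underline2,2)$; $E(\gamma',\gamma)=1$ if $\gamma'<\gamma$ and $(\gamma',\gamma)\ne(\underline2,2)$, or if $(\gamma',\gamma)=(4,\underline4)$; and $E(\gamma',\gamma)=2$ otherwise. The monomial $\underline x$ satisfies the difference conditions (DC) if $r_{t+1}-r_t\ge E(\gamma_{t+1},\gamma_t)$ for $1\le t<n$. For $\gamma\in\Gamma$, $\underline x$ satisfies $\mathrm{IC}_\gamma$ if $n=0$, or $r_1\ge2$, or $r_1=1$ and $\gamma_1\le\gamma$ (in the case $\gamma\neq4$), respectively $\gamma_1\in\{\underline2,\underline3,4\}$ (in the case $\gamma=4$); it satisfies $\mathrm{IC}_0$ if $n=0$ or $r_1\ge2$. For $\gamma\in\Gamma\cup\{0\}$ and $\alpha$ in the root lattice put $$\chi_\gamma^\alpha(q)=\sum q^{d(\underline x)},$$ the sum over all $\underline x$ with $w(\underline x)=\alpha$ that satisfy DC and $\mathrm{IC}_\gamma$. For $k\in\{0,1,3,4\}$ let $\chi_{W(\Lambda_k)}^\alpha(q)$ be the same sum over the $\underline x$ with $w(\underline x)=\alpha$ that satisfy DC and the initial conditions for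 $L(\Lambda_k)$: $n=0$, or $r_1\ge2$, or $r_1=1$ and $\gamma_1\in\Gamma$ for $k=0$, $\gamma_1\in\{\underline2,\underline3,4\}$ for $k=3$, $\gamma_1\in\{\underline2,\underline3,\underline4\}$ for $k=4$ (for $k=1$, $r_1=1$ is not allowed). These monomials index the monomial basis of the Feigin--Stoyanovsky type subspace $W(\Lambda_k)$ of the level one standard module $L(\Lambda_k)$ of type $D_4^{(1)}$, and $\chi^\alpha_{W(\Lambda_k)}$ is, by definition, the weight-$\alpha$ part of the character of $W(\Lambda_k)$. Let $(q)_n=(1-q)\cdots(1-q^n)$; let $\theta(n)=0$ for $n<0$ and $\theta(n)=1$ for $n\ge0$. Let $n_1,n_2,n_3,n_4$ be integers such that $$n_1-n_2+n_4,\quad n_1-n_2+n_3,\quad n_2-n_3,\quad n_1-n_3,\quad n_3,\quad n_2-n_4,\quad n_4,\quad n_1-n_4$$ are all nonnegative, and set $\alpha=n_1\alpha_1+n_2\alpha_2+n_3\alpha_3+n_4\alpha_4$. Put $m_{\underline2}=n_1-n_2$, $m_{\underline3}=n_2-n_3-n_4$, $m_{\underline4}=n_3-n_4$, $m'=-\theta(-m_{\underline2})m_{\underline2}-\theta(-m_{\underline4})m_{\underline4}$,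 $m''=-\theta(-m_{\underline3})m_{\underline3}$, and, for $0\le i\le n_4-m'-m''$, write $j=i+m'$, $$f_i(\alpha)=n_1^2+n_2^2+n_3^2+n_4^2-n_1n_2-n_2n_3-n_3n_4-j(n_2-n_3+n_4-j),$$ $$\rho_i=\frac{(1-q^{n_3-n_4+j})(1-q^{j})}{1-q^{n_1-n_2+n_3-n_4+2j}},$$ where $\rho_i=0$ if $n_1-n_2+n_3-n_4+2j=0$ (in which case $j=n_3-n_4+j=0$). **Theorem.** For every $\gamma\in\Gamma\cup\{0\}$, as formal power series in $q$, $$\chi_\gamma^\alpha(q)=\sum_{i=0}^{n_4-m'-m''} d_\gamma(\alpha)\, \frac{q^{f_i(\alpha)}\,(q)_{n_1-n_2+n_3-n_4+2j}}{(q)_{n_3-n_4+j}\,(q)_{n_1-n_2+j}\,(q)_{j}\,(q)_{n_1-n_2+n_3-n_4+j}\,(q)_{n_4-j}\,(q)_{n_2-n_3-j}},$$ where $d_2(\alpha)=1$, $d_3(\alpha)=1-\rho_i$, $d_4(\alpha)=q^{n_3}$, $d_{\underline4}(\alpha)=q^{n_4}$, $d_{\underline3}(\alpha)=q^{n_3+j}+q^{n_1-n_2+n_3+j}\rho_i$,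 $d_{\underline2}(\alpha)=q^{n_2}+q^{n_1}\rho_i$, $d_0(\alpha)=q^{n_1}$. Moreover, $\chi_{W(\Lambda_0)}^\alpha$, $\chi_{W(\Lambda_1)}^\alpha$, $\chi_{W(\Lambda_3)}^\alpha$ and $\chi_{W(\Lambda_4)}^\alpha$ are given by the right-hand side for $\gamma=2$, $\gamma=0$, $\gamma=4$ and $\gamma=\underline4$, respectively. -/

import Mathlib

noncomputable section

namespace D4Char

open PowerSeries

/-! ## Colors, monomials, and their weights and degrees -/

/-- The six colors for `D₄` and the minuscule weight `ω₁`, listed in increasing order: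
`u2, u3, u4` stand for the underlined colors `2̲, 3̲, 4̲`, and `c4, c3, c2` for `4, 3, 2`. -/
inductive Color where
  | u2 | u3 | u4 | c4 | c3 | c2
  deriving DecidableEq

namespace Color

instance : Fintype Color where
  elems := {u2, u3, u4, c4, c3, c2}
  complete x := by cases x <;> decide

/-- Position in the order `2̲ < 3̲ < 4̲ < 4 < 3 < 2`. -/
def rank : Color → ℕ
  | u2 => 0
  | u3 => 1
  | u4 => 2
  | c4 => 3
  | c3 => 4
  | c2 => 5

theorem rank_injective : Function.Injective rank := by
  intro a b h
  cases a <;> cases b <;> first | rfl | simp [rank] at h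

instance : LinearOrder Color := LinearOrder.lift' rank rank_injective

/-- The root of `D₄` which a color is, in coordinates with respect to the simple roots
`α₁, α₂, α₃, α₄` (`α₂` is the one joined to the other three). -/
def root : Color → (Fin 4 → ℤ)
  | u2 => ![1, 0, 0, 0]
  | u3 => ![1, 1, 0, 0]
  | u4 => ![1, 1, 1, 0]
  | c4 => ![1, 1, 0, 1]
  | c3 => ![1, 1, 1, 1]
  | c2 => ![1, 2, 1, 1]

/-- The colors are exactly the roots `v` of `D₄` (elements of the root lattice with
`⟨v, v⟩ = 2`) such that `⟨v, ω₁⟩ = 1`. -/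
theorem range_root :
    Set.range root = {v : Fin 4 → ℤ | v ⬝ᵥ (CartanMatrix.D 4).mulVec v = 2 ∧ v 0 = 1} := by
  ext v
  have key : v ⬝ᵥ (CartanMatrix.D 4).mulVec v =
      2 * (v 0 ^ 2 + v 1 ^ 2 + v 2 ^ 2 + v 3 ^ 2 - v 0 * v 1 - v 1 * v 2 - v 1 * v 3) := by
    simp [dotProduct, Matrix.mulVec, Fin.sum_univ_four, CartanMatrix.D]
    ring
  rw [Set.mem_ofPred_eq, key]
  constructor
  · rintro ⟨c, rfl⟩
    cases c <;> simp [root]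
  · rintro ⟨h, h0⟩
    have hv : v = ![1, v 1, v 2, v 3] := by
      funext i
      fin_cases i <;> simp [h0]
    rw [hv]
    rw [h0] at h
    generalize v 1 = b at h
    generalize v 2 = c at h
    generalize v 3 = d at h
    have e : (b - 2 * c) ^ 2 + (b - 2 * d) ^ 2 + 2 * (b - 1) ^ 2 = 2 := by nlinarith
    have b0 : 0 ≤ b := by nlinarith [sq_nonneg (b - 2 * c), sq_nonneg (b - 2 * d)]
    have b2 : b ≤ 2 := by nlinarith [sq_nonneg (b - 2 * c), sq_nonneg (b - 2 * d)]
    have c0 : 0 ≤ c := by nlinarith [sq_nonneg (b - 1), sq_nonneg (b - 2 * d)]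
    have c1 : c ≤ 1 := by nlinarith [sq_nonneg (b - 1), sq_nonneg (b - 2 * d)]
    have d0 : 0 ≤ d := by nlinarith [sq_nonneg (b - 1), sq_nonneg (b - 2 * c)]
    have d1 : d ≤ 1 := by nlinarith [sq_nonneg (b - 1), sq_nonneg (b - 2 * c)]
    interval_cases b <;> interval_cases c <;> interval_cases d <;>
      first
      | (exfalso; omega)
      | exact ⟨u2, rfl⟩
      | exact ⟨u3, rfl⟩
      | exact ⟨u4, rfl⟩
      | exact ⟨c4, rfl⟩
      | exact ⟨c3, rfl⟩
      | exact ⟨c2, rfl⟩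

end Color

open Color

/-- The pair `(γ, r)` stands for the variable `x_γ(-r)`. -/
abbrev Var := Color × ℕ

/-- `x_γ(-r) ≤ x_γ'(-r')` if `-r < -r'`, or `r = r'` and `γ ≤ γ'`. -/
def Var.LE (x y : Var) : Prop := y.2 < x.2 ∨ (x.2 = y.2 ∧ x.1 ≤ y.1)

/-- A monomial `x_{γₙ}(-rₙ) ⋯ x_{γ₁}(-r₁)` in commuting variables, with its factors sorted
ascendingly from left to right, is represented by the list `[(γ₁, r₁), …, (γₙ, rₙ)]`,
that is, the list is read from the right end of the monomial. -/
abbrev Mon := List Var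

/-- All `r_t` are positive, and the factors are sorted. -/
def IsMonomial (x : Mon) : Prop :=
  (∀ a ∈ x, 1 ≤ a.2) ∧ x.IsChain (fun a b => Var.LE b a)

/-- The weight `γ₁ + ⋯ + γₙ`. -/
def weight (x : Mon) : Fin 4 → ℤ := (x.map fun a => a.1.root).sum

/-- The degree `r₁ + ⋯ + rₙ`. -/
def degree (x : Mon) : ℕ := (x.map fun a => a.2).sum

/-- The energy function `E(γ', γ)`. -/
def energy (γ' γ : Color) : ℕ :=
  if γ' = u2 ∧ γ = c2 then 0
  else if γ' < γ ∨ (γ' = c4 ∧ γ = u4) then 1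
  else 2

/-- Difference conditions: `r_{t+1} - r_t ≥ E(γ_{t+1}, γ_t)`. -/
def DC (x : Mon) : Prop := x.IsChain fun a b => a.2 + energy b.1 a.1 ≤ b.2

/-- Initial conditions: `r₁ ≥ 2`, or `r₁ = 1` and `γ₁` belongs to the set `S`
(no condition on the empty monomial). -/
def IC (S : Set Color) (x : Mon) : Prop :=
  ∀ a ∈ x.head?, 2 ≤ a.2 ∨ (a.2 = 1 ∧ a.1 ∈ S)

/-- Monomials satisfying the difference conditions and the initial conditions given by `S`. -/
def admissible (S : Set Color) : Set Mon := {x | IsMonomial x ∧ DC x ∧ IC S x}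

/-- The elements of `B` of weight `α` and degree `d`. -/
def graded (B : Set Mon) (α : Fin 4 → ℤ) (d : ℕ) : Set Mon :=
  {x ∈ B | weight x = α ∧ degree x = d}

theorem graded_finite (S : Set Color) (α : Fin 4 → ℤ) (d : ℕ) :
    (graded (admissible S) α d).Finite := by
  have key : ∀ x : Mon, (∀ a ∈ x, 1 ≤ a.2) →
      x.length ≤ degree x ∧ ∀ a ∈ x, a.2 ≤ degree x := by
    intro x
    induction x with
    | nil => simp
    | cons b t ih =>
      intro h
      obtain ⟨h1, h2⟩ := ih fun a ha => h a (List.mem_cons_of_mem _ ha)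
      have hb := h b List.mem_cons_self
      have hd : degree (b :: t) = b.2 + degree t := by simp [degree]
      refine ⟨by rw [hd, List.length_cons]; omega, ?_⟩
      intro a ha
      rw [hd]
      rcases List.mem_cons.1 ha with rfl | ha
      · omega
      · have := h2 a ha
        omega
  have hfin : {l : List (Color × Fin (d + 1)) | l.length ≤ d}.Finite :=
    List.finite_length_le _ d
  refine (hfin.image fun l => l.map fun a => ((a.1, (a.2 : ℕ)) : Var)).subset ?_
  rintro x ⟨⟨⟨hpos, -⟩, -⟩, -, rfl⟩
  obtain ⟨h1, h2⟩ := key x hpos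
  refine ⟨x.map fun a => (a.1, Fin.ofNat _ a.2), by simpa using h1, ?_⟩
  simp only [List.map_map]
  conv_rhs => rw [← List.map_id x]
  refine List.map_congr_left fun a ha => ?_
  have := h2 a ha
  simp only [Function.comp, id, Fin.ofNat]
  rw [Nat.mod_eq_of_lt (by omega)]

/-- The formal series `∑ q ^ d(x)` over the elements `x` of `B` of weight `α`. -/
def genSeries (B : Set Mon) (α : Fin 4 → ℤ) : ℚ⟦X⟧ :=
  PowerSeries.mk fun d => ((graded B α d).ncard : ℚ)

/-! ## Initial conditions -/

/-- The colors allowed at `r₁ = 1` by `IC_γ`, where `γ ∈ Γ ∪ {0}`; `none` stands for `0`. -/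
def allowed : Option Color → Set Color
  | none => ∅
  | some c4 => {u2, u3, c4}
  | some γ => {δ | δ ≤ γ}

/-- The set `𝔅_γ`. -/
def basis (γ : Option Color) : Set Mon := admissible (allowed γ)

/-- The series `χ_γ^α(q)`. -/
def chi (γ : Option Color) (α : Fin 4 → ℤ) : ℚ⟦X⟧ := genSeries (basis γ) α

/-- The fundamental weights of level one of the affine Lie algebra of type `D₄⁽¹⁾`. -/
inductive LevelOne where
  | Λ0 | Λ1 | Λ3 | Λ4

/-- The colors allowed at `r₁ = 1` by the initial conditions for `L(Λ_k)`. -/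
def allowedW : LevelOne → Set Color
  | .Λ0 => {u2, u3, u4, c4, c3, c2}
  | .Λ1 => ∅
  | .Λ3 => {u2, u3, c4}
  | .Λ4 => {u2, u3, u4}

/-- The set of monomials that satisfy the difference conditions and the initial conditions
for `L(Λ_k)`; applied to the highest weight vector they give the monomial basis of `W(Λ_k)`. -/
def basisW (Λ : LevelOne) : Set Mon := admissible (allowedW Λ)

/-- The coefficient `χ_{W(Λ_k)}^α(q)` of the character of `W(Λ_k)`. -/
def chiW (Λ : LevelOne) (α : Fin 4 → ℤ) : ℚ⟦X⟧ := genSeries (basisW Λ) α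

/-! ## The right-hand side -/

/-- `q ^ a`, used for `a ≥ 0` only. -/
def qpow (a : ℤ) : ℚ⟦X⟧ := X ^ a.toNat

/-- `(q)_a = (1 - q) ⋯ (1 - q ^ a)`, used for `a ≥ 0` only. -/
def qfac (a : ℤ) : ℚ⟦X⟧ := ∏ j ∈ Finset.range a.toNat, (1 - X ^ (j + 1))

/-- `θ(n) = 0` for `n < 0`, and `θ(n) = 1` for `n ≥ 0`. -/
def theta (n : ℤ) : ℤ := if n < 0 then 0 else 1

/-- The weights that are sums of colors. -/
def Admissible (n₁ n₂ n₃ n₄ : ℤ) : Prop :=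
  0 ≤ n₁ - n₂ + n₄ ∧ 0 ≤ n₁ - n₂ + n₃ ∧
  0 ≤ n₂ - n₃ ∧ 0 ≤ n₁ - n₃ ∧
  0 ≤ n₃ ∧ 0 ≤ n₂ - n₄ ∧
  0 ≤ n₄ ∧ 0 ≤ n₁ - n₄

/-- `m' = -θ(-m_{2̲}) m_{2̲} - θ(-m_{4̲}) m_{4̲}`, with `m_{2̲} = n₁ - n₂`, `m_{4̲} = n₃ - n₄`. -/
def m' (n₁ n₂ n₃ n₄ : ℤ) : ℤ :=
  -theta (-(n₁ - n₂)) * (n₁ - n₂) - theta (-(n₃ - n₄)) * (n₃ - n₄)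

/-- `m'' = -θ(-m_{3̲}) m_{3̲}`, with `m_{3̲} = n₂ - n₃ - n₄`. -/
def m'' (n₂ n₃ n₄ : ℤ) : ℤ := -theta (-(n₂ - n₃ - n₄)) * (n₂ - n₃ - n₄)

/-- The exponent `f_i(α)`, where `j = i + m'`. -/
def f (n₁ n₂ n₃ n₄ j : ℤ) : ℤ :=
  n₁ ^ 2 + n₂ ^ 2 + n₃ ^ 2 + n₄ ^ 2 - n₁ * n₂ - n₂ * n₃ - n₃ * n₄ - j * (n₂ - n₃ + n₄ - j)

/-- `(1 - q^{n₃-n₄+j}) (1 - q^j) / (1 - q^{n₁-n₂+n₃-n₄+2j})`, where `j = i + m'`. If the exponent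
in the denominator is `0`, so are both exponents in the numerator, and the value is `0`. -/
def ratio (n₁ n₂ n₃ n₄ j : ℤ) : ℚ⟦X⟧ :=
  if n₁ - n₂ + n₃ - n₄ + 2 * j = 0 then 0
  else (1 - qpow (n₃ - n₄ + j)) * (1 - qpow j) * (1 - qpow (n₁ - n₂ + n₃ - n₄ + 2 * j))⁻¹

/-- The factor `d_γ(α)`, where `j = i + m'`. -/
def d (γ : Option Color) (n₁ n₂ n₃ n₄ j : ℤ) : ℚ⟦X⟧ :=
  match γ with
  | some c2 => 1
  | some c3 => 1 - ratio n₁ n₂ n₃ n₄ j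
  | some c4 => qpow n₃
  | some u4 => qpow n₄
  | some u3 => qpow (n₃ + j) + qpow (n₁ - n₂ + n₃ + j) * ratio n₁ n₂ n₃ n₄ j
  | some u2 => qpow n₂ + qpow n₁ * ratio n₁ n₂ n₃ n₄ j
  | none => qpow n₁

/-- The summand without the factor `d_γ(α)`, where `j = i + m'`. -/
def summand (n₁ n₂ n₃ n₄ j : ℤ) : ℚ⟦X⟧ :=
  qpow (f n₁ n₂ n₃ n₄ j) * qfac (n₁ - n₂ + n₃ - n₄ + 2 * j) *
    (qfac (n₃ - n₄ + j) * qfac (n₁ - n₂ + j) * qfac j *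
      qfac (n₁ - n₂ + n₃ - n₄ + j) * qfac (n₄ - j) * qfac (n₂ - n₃ - j))⁻¹

/-- The right-hand side of the character formula. -/
def formula (γ : Option Color) (n₁ n₂ n₃ n₄ : ℤ) : ℚ⟦X⟧ :=
  ∑ i ∈ Finset.Icc (0 : ℤ) (n₄ - m' n₁ n₂ n₃ n₄ - m'' n₂ n₃ n₄),
    d γ n₁ n₂ n₃ n₄ (i + m' n₁ n₂ n₃ n₄) * summand n₁ n₂ n₃ n₄ (i + m' n₁ n₂ n₃ n₄)

/-- All exponents and all indices of `(q)_a` in the formula are nonnegative, the upper bound of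
summation is nonnegative, and the convention in `ratio` concerns the value `0 / 0` only. -/
theorem formula_indices_nonneg (n₁ n₂ n₃ n₄ : ℤ) (h : Admissible n₁ n₂ n₃ n₄) :
    0 ≤ n₁ ∧ 0 ≤ n₂ ∧ 0 ≤ n₃ ∧ 0 ≤ n₄ ∧ 0 ≤ n₄ - m' n₁ n₂ n₃ n₄ - m'' n₂ n₃ n₄ ∧
    ∀ i ∈ Finset.Icc (0 : ℤ) (n₄ - m' n₁ n₂ n₃ n₄ - m'' n₂ n₃ n₄),
    ∀ j, j = i + m' n₁ n₂ n₃ n₄ →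
      0 ≤ f n₁ n₂ n₃ n₄ j ∧ 0 ≤ n₁ - n₂ + n₃ - n₄ + 2 * j ∧ 0 ≤ n₃ - n₄ + j ∧
      0 ≤ n₁ - n₂ + j ∧ 0 ≤ j ∧ 0 ≤ n₁ - n₂ + n₃ - n₄ + j ∧ 0 ≤ n₄ - j ∧
      0 ≤ n₂ - n₃ - j ∧ 0 ≤ n₃ + j ∧ 0 ≤ n₁ - n₂ + n₃ + j ∧
      (n₁ - n₂ + n₃ - n₄ + 2 * j = 0 → n₃ - n₄ + j = 0 ∧ j = 0) := by
  obtain ⟨h1, h2, h3, h4, h5, h6, h7, h8⟩ := h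
  have a1 : m' n₁ n₂ n₃ n₄ = max 0 (-(n₁ - n₂)) + max 0 (-(n₃ - n₄)) := by
    unfold m' theta
    split_ifs <;> omega
  have a2 : m'' n₂ n₃ n₄ = max 0 (-(n₂ - n₃ - n₄)) := by
    unfold m'' theta
    split_ifs <;> omega
  rw [a1, a2]
  refine ⟨by omega, by omega, by omega, by omega, by omega, ?_⟩
  intro i hi j hj
  rw [Finset.mem_Icc] at hi
  refine ⟨?_, by omega, by omega, by omega, by omega, by omega, by omega, by omega, by omega,
    by omega, by omega⟩
  unfold f
  nlinarith [sq_nonneg (n₁ - n₂), sq_nonneg (n₂ - n₃), sq_nonneg (n₃ - n₄), sq_nonneg n₁,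
    sq_nonneg (2 * j - (n₂ - n₃ + n₄)), sq_nonneg (n₂ - n₃ - n₄), sq_nonneg n₂, sq_nonneg n₄,
    sq_nonneg (2 * n₁ - n₂), sq_nonneg (3 * n₂ - 2 * n₃), sq_nonneg n₃]

end D4Char

end

/-! The series satisfy a recursion in the number of factors, which equals `n₁` since every color has
`α₁`-coefficient 1. Sort monomials by whether they end in `x_c(-1)`. Removing that factor and
lowering all other degrees by one leaves a monomial whose initial condition is the set of `b` with
`energy b c = 1`, and the degree drops by exactly `n₁`. Only `c = c2` is different: `energy u2 c2 =
0` also allows a tail that starts with `x_{u2}(-1)`. The set belonging to `c3` is none of the sets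
`allowed γ`, but inclusion-exclusion expresses its series by those of `u4`, `c4` and `u3`. Finally,
shifting all degrees turns the condition with `r₁ = 1` forbidden into the one with no restriction on
colors, which gives `χ_0 = q^{n₁} χ_2`. This is `CharSystem`, established in `chi_system`.

The system has only one solution (`CharSystem.unique`): the equations of a fixed weight add up to
`(1 - q^{n₁}) χ_2 = ` terms with first coordinate `n₁ - 1`, and `q^{n₁} ≠ 1` for `n₁ > 0`.

The formula solves the system too (`fieldFormula_system`), summand by summand. The lemmas
`term_sub_*` compute the quotient of the summands at `α - c` and `α`, with `j` lowered by one when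
`c` is `c4` or `c2`. Since the recursion leaves the cone of admissible weights, this is done for all
integer weights in a field, with `1/(q)_n = 0` for `n < 0`. Admissibility enters only when the
result is carried back to power series (`algebraMap_formula`). -/

noncomputable section

namespace D4Char

open PowerSeries Color

/-! ### Decomposition of monomials by their rightmost factor -/

section Monomials

/-- Lists that satisfy the difference conditions and whose first variable satisfies `p`. -/
def region (p : Var → Prop) : Set Mon := {x | DC x ∧ ∀ a ∈ x.head?, p a}

theorem cons_mem_region {p : Var → Prop} {a : Var} {x : Mon} :
    a :: x ∈ region p ↔ p a ∧ x ∈ region fun b => a.2 + energy b.1 a.1 ≤ b.2 := by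
  simp only [region, DC, Set.mem_ofPred_eq, List.isChain_cons, List.head?_cons, Option.mem_some_iff,
    forall_eq']
  tauto

theorem nil_mem_region {p : Var → Prop} : [] ∈ region p := by simp [region, DC]

theorem region_mono {p p' : Var → Prop} (h : ∀ a, p a → p' a) : region p ⊆ region p' :=
  fun _ hx => ⟨hx.1, fun a ha => h a (hx.2 a ha)⟩

theorem le_of_mem_region {k : ℕ} {x : Mon} (hx : x ∈ region fun a => k ≤ a.2) :
    ∀ a ∈ x, k ≤ a.2 := by
  induction x with
  | nil => simp
  | cons b x ih =>
    rw [cons_mem_region] at hx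
    intro a ha
    rcases List.mem_cons.1 ha with rfl | ha
    · exact hx.1
    · exact ih (region_mono (fun c hc => by have := hx.1; omega) hx.2) a ha

/-- Degrees can tie only where the energy is 0, that is for `u2` following `c2`, and there the tie
is in the right order. -/
theorem isChain_of_DC {x : Mon} (hx : DC x) : x.IsChain fun a b => Var.LE b a := by
  refine List.IsChain.imp (fun a b h => ?_) hx
  obtain ⟨γ, r⟩ := a
  obtain ⟨γ', r'⟩ := b
  simp only [Var.LE, energy] at h ⊢
  split_ifs at h with h1 h2
  · obtain ⟨rfl, rfl⟩ := h1
    rcases lt_or_eq_of_le (show r ≤ r' by omega) with h | h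
    · exact Or.inl h
    · exact Or.inr ⟨h.symm, by decide⟩
  · exact Or.inl (by omega)
  · exact Or.inl (by omega)

/-- Positivity and sortedness follow from DC and the initial condition, so only a condition on
consecutive factors and one on the first remain. -/
theorem admissible_eq_region (S : Set Color) :
    admissible S = region fun a => 2 ≤ a.2 ∨ a.2 = 1 ∧ a.1 ∈ S := by
  ext x
  constructor
  · rintro ⟨-, h2, h3⟩
    exact ⟨h2, h3⟩
  · intro hx
    refine ⟨⟨le_of_mem_region (region_mono (fun a ha => ?_) hx), isChain_of_DC hx.1⟩, hx.1, hx.2⟩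
    rcases ha with ha | ha <;> omega

/-- Shift all degrees by one. -/
def shift (x : Mon) : Mon := x.map fun a => (a.1, a.2 + 1)

theorem shift_injective : Function.Injective shift := by
  refine List.map_injective_iff.2 fun a b h => ?_
  simpa [Prod.ext_iff] using h

theorem shift_mem_region {p : Var → Prop} {x : Mon} :
    shift x ∈ region p ↔ x ∈ region fun a => p (a.1, a.2 + 1) := by
  simp only [region, DC, shift, Set.mem_ofPred_eq, List.isChain_map, List.head?_map]
  refine and_congr ?_ ?_
  · have : (fun a b : Var => a.2 + 1 + energy b.1 a.1 ≤ b.2 + 1) =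
        fun a b => a.2 + energy b.1 a.1 ≤ b.2 := by
      funext a b
      exact propext (by omega)
    rw [this]
  · cases x <;> simp

theorem image_shift_region {p : Var → Prop} (hp : ∀ a, p a → 1 ≤ a.2) :
    shift '' region (fun a => p (a.1, a.2 + 1)) = region p := by
  ext x
  constructor
  · rintro ⟨y, hy, rfl⟩
    exact shift_mem_region.2 hy
  · intro hx
    -- Since all degrees are at least 1, the truncated subtraction below really inverts the shift.
    have hpos := le_of_mem_region (region_mono hp hx)
    have e : shift (x.map fun a => (a.1, a.2 - 1)) = x := by
      rw [shift, List.map_map]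
      conv_rhs => rw [← List.map_id x]
      refine List.map_congr_left fun a ha => ?_
      have := hpos a ha
      simp only [Function.comp, id]
      rw [Nat.sub_add_cancel this]
    exact ⟨_, shift_mem_region.1 (by rwa [e]), e⟩

theorem image_shift_admissible (S : Set Color) :
    shift '' admissible S = region fun a => 3 ≤ a.2 ∨ a.2 = 2 ∧ a.1 ∈ S := by
  rw [admissible_eq_region, ← image_shift_region (p := fun a => 3 ≤ a.2 ∨ a.2 = 2 ∧ a.1 ∈ S)]
  · congr! 4 with a
    · simp
    · simp
  · rintro a (h | h) <;> omega

/-- The admissible monomials with rightmost factor `x_c(-1)`. -/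
def starting (c : Color) : Set Mon :=
  (List.cons (c, 1)) '' region fun b => 1 + energy b.1 c ≤ b.2

theorem mem_starting {c : Color} {x : Mon} : x ∈ starting c ↔ DC x ∧ x.head? = some (c, 1) := by
  have h := fun y => @cons_mem_region (fun _ => True) (c, 1) y
  constructor
  · rintro ⟨y, hy, rfl⟩
    exact ⟨((h y).2 ⟨trivial, hy⟩).1, rfl⟩
  · rintro ⟨h1, h2⟩
    cases x with
    | nil => simp at h2
    | cons a x =>
      obtain rfl : a = (c, 1) := by simpa using h2
      exact ⟨x, ((h x).1 ⟨h1, fun _ _ => trivial⟩).2, rfl⟩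

theorem admissible_insert (S : Set Color) (c : Color) :
    admissible (insert c S) = admissible S ∪ starting c := by
  ext x
  rw [Set.mem_union, mem_starting, admissible_eq_region, admissible_eq_region]
  cases x with
  | nil => simp [nil_mem_region]
  | cons a x =>
    have h := @cons_mem_region (fun _ => True) a x
    have h' : a :: x ∈ region (fun _ => True) ↔ DC (a :: x) :=
      ⟨fun h => h.1, fun h => ⟨h, fun _ _ => trivial⟩⟩
    rw [← h', cons_mem_region, cons_mem_region, cons_mem_region]
    simp only [Set.mem_insert_iff, List.head?_cons, Option.some.injEq, Prod.ext_iff]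
    tauto

theorem disjoint_admissible_starting {S : Set Color} {c : Color} (hc : c ∉ S) :
    Disjoint (admissible S) (starting c) := by
  rw [Set.disjoint_left]
  intro x hx hx'
  rcases hx.2.2 (c, 1) (mem_starting.1 hx').2 with h | h
  · simp at h
  · exact hc h.2

/-- Forbidding `r₁ = 1` means `r₁ ≥ 2`, which is the unrestricted condition `r₁ ≥ 1` raised by one.
-/
theorem admissible_empty : admissible ∅ = shift '' admissible Set.univ := by
  rw [image_shift_admissible, admissible_eq_region]
  congr 1
  funext a
  exact propext (by simp; omega)

/-- After `x_c(-1)` the next factor needs degree at least `1 + E`; for `E ∈ {1, 2}` this is the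
initial condition of `S` moved up by one degree. -/
theorem starting_eq_image {c : Color} {S : Set Color}
    (h1 : ∀ b ∈ S, energy b c = 1) (h2 : ∀ b ∉ S, energy b c = 2) :
    starting c = (fun x => (c, 1) :: shift x) '' admissible S := by
  rw [starting, ← Set.image_image (List.cons (c, 1)) shift, image_shift_admissible]
  congr 2
  funext a
  by_cases ha : a.1 ∈ S
  · simp only [h1 _ ha, ha]
    exact propext (by simp; omega)
  · simp only [h2 _ ha, ha]
    exact propext (by simp)

/-- The pair `(u2, c2)` of energy 0 is the only obstruction to the previous description: it allows a
tail starting with `x_{u2}(-1)`, which is not in the image of `shift`. -/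
theorem starting_c2 :
    starting c2 = (fun x => (c2, 1) :: shift x) '' admissible {c2}ᶜ ∪
      (List.cons (c2, 1)) '' starting u2 := by
  rw [← Set.image_image (List.cons (c2, 1)) shift, ← Set.image_union, image_shift_admissible]
  rw [starting]
  congr 1
  ext x
  rw [Set.mem_union, mem_starting]
  cases x with
  | nil => simp [nil_mem_region]
  | cons a x =>
    have h' : a :: x ∈ region (fun _ => True) ↔ DC (a :: x) :=
      ⟨fun h => h.1, fun h => ⟨h, fun _ _ => trivial⟩⟩
    rw [← h', cons_mem_region, cons_mem_region, cons_mem_region]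
    simp only [List.head?_cons, Option.some.injEq, Prod.ext_iff]
    have e : 1 + energy a.1 c2 ≤ a.2 ↔ (3 ≤ a.2 ∨ a.2 = 2 ∧ a.1 ∈ ({c2}ᶜ : Set Color)) ∨
        (a.1 = u2 ∧ a.2 = 1) := by
      obtain ⟨γ, r⟩ := a
      have h : ∀ γ, energy γ c2 = if γ = u2 then 0 else if γ = c2 then 2 else 1 := by decide
      simp only [h, Set.mem_compl_iff, Set.mem_singleton_iff]
      cases γ <;> simp <;> omega
    rw [e]
    tauto

/-! ### Generating series of the pieces -/

theorem weight_cons (a : Var) (x : Mon) : weight (a :: x) = a.1.root + weight x := by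
  simp [weight]

theorem degree_cons (a : Var) (x : Mon) : degree (a :: x) = a.2 + degree x := by
  simp [degree]

theorem weight_shift (x : Mon) : weight (shift x) = weight x := by
  simp [weight, shift, Function.comp_def]

theorem degree_shift (x : Mon) : degree (shift x) = degree x + x.length := by
  induction x with
  | nil => simp [shift, degree]
  | cons a x ih =>
    have : shift (a :: x) = (a.1, a.2 + 1) :: shift x := rfl
    rw [this, degree_cons, degree_cons, ih, List.length_cons]
    omega

/-- This turns the degree gained by `shift`, one per factor, into a function of the weight alone. -/
theorem weight_zero (x : Mon) : weight x 0 = x.length := by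
  induction x with
  | nil => simp [weight]
  | cons a x ih =>
    have h : ∀ c : Color, c.root 0 = 1 := by
      intro c
      cases c <;> simp [root]
    rw [weight_cons, Pi.add_apply, ih, h, List.length_cons]
    push_cast
    ring

theorem genSeries_union {A B : Set Mon} {α : Fin 4 → ℤ} (h : Disjoint A B)
    (hA : ∀ d, (graded A α d).Finite) (hB : ∀ d, (graded B α d).Finite) :
    genSeries (A ∪ B) α = genSeries A α + genSeries B α := by
  ext d
  have e : graded (A ∪ B) α d = graded A α d ∪ graded B α d := by
    ext x
    simp only [graded, Set.mem_union, Set.mem_ofPred_eq]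
    tauto
  have hd : Disjoint (graded A α d) (graded B α d) :=
    h.mono (fun x hx => hx.1) (fun x hx => hx.1)
  simp only [genSeries, map_add, coeff_mk]
  rw [e, Set.ncard_union_eq hd (hA d) (hB d), Nat.cast_add]

theorem genSeries_image {A : Set Mon} {φ : Mon → Mon} (hφ : Function.Injective φ)
    {α β : Fin 4 → ℤ} {e : ℕ} (hw : ∀ x ∈ A, weight (φ x) = β ↔ weight x = α)
    (hd : ∀ x ∈ A, weight x = α → degree (φ x) = degree x + e) :
    genSeries (φ '' A) β = X ^ e * genSeries A α := by
  ext d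
  rw [coeff_X_pow_mul']
  simp only [genSeries, coeff_mk]
  split_ifs with h
  · have : graded (φ '' A) β d = φ '' graded A α (d - e) := by
      ext y
      constructor
      · rintro ⟨⟨x, hx, rfl⟩, h1, h2⟩
        have h3 := (hw x hx).1 h1
        exact ⟨x, ⟨hx, h3, by rw [hd x hx h3] at h2; omega⟩, rfl⟩
      · rintro ⟨x, ⟨hx, h1, h2⟩, rfl⟩
        exact ⟨⟨x, hx, rfl⟩, (hw x hx).2 h1, by rw [hd x hx h1]; omega⟩
    rw [this, Set.ncard_image_of_injective _ hφ]
  · have : graded (φ '' A) β d = ∅ := by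
      refine Set.eq_empty_of_forall_notMem ?_
      rintro _ ⟨⟨x, hx, rfl⟩, h1, h2⟩
      rw [hd x hx ((hw x hx).1 h1)] at h2
      omega
    simp [this]

theorem starting_subset (c : Color) : starting c ⊆ admissible {c} := by
  have h := admissible_insert ∅ c
  rw [insert_empty_eq] at h
  rw [h]
  exact Set.subset_union_right

theorem graded_finite_of_subset {A : Set Mon} {S : Set Color} (h : A ⊆ admissible S)
    (α : Fin 4 → ℤ) (d : ℕ) : (graded A α d).Finite :=
  (graded_finite S α d).subset fun _ hx => ⟨h hx.1, hx.2⟩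

theorem genSeries_insert {S : Set Color} {c : Color} (hc : c ∉ S) (α : Fin 4 → ℤ) :
    genSeries (admissible (insert c S)) α =
      genSeries (admissible S) α + genSeries (starting c) α := by
  rw [admissible_insert]
  exact genSeries_union (disjoint_admissible_starting hc) (graded_finite S α)
    (graded_finite_of_subset (starting_subset c) α)

theorem genSeries_admissible_empty (α : Fin 4 → ℤ) :
    genSeries (admissible ∅) α = X ^ (α 0).toNat * genSeries (admissible Set.univ) α := by
  rw [admissible_empty]
  refine genSeries_image shift_injective (fun x _ => by rw [weight_shift]) fun x _ hx => ?_
  rw [degree_shift, ← hx, weight_zero, Int.toNat_natCast]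

/-- The tail has `α 0 - 1` factors, each raised by one, and the new factor has degree 1; together
the degree grows by `α 0`. -/
theorem genSeries_image_cons_shift (c : Color) (S : Set Color) (α : Fin 4 → ℤ) :
    genSeries ((fun x => (c, 1) :: shift x) '' admissible S) α =
      X ^ (α 0).toNat * genSeries (admissible S) (α - c.root) := by
  refine genSeries_image (fun x y h => shift_injective (List.cons_injective h))
    (fun x _ => ?_) fun x _ hx => ?_
  · rw [weight_cons, weight_shift, eq_sub_iff_add_eq, add_comm]
  · have h := congrArg (fun v => v 0) (eq_sub_iff_add_eq.1 hx)
    have hc : c.root 0 = 1 := by cases c <;> simp [root]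
    simp only [Pi.add_apply, weight_zero, hc] at h
    rw [degree_cons, degree_shift, ← h]
    omega

theorem genSeries_starting {c : Color} {S : Set Color}
    (h1 : ∀ b ∈ S, energy b c = 1) (h2 : ∀ b ∉ S, energy b c = 2) (α : Fin 4 → ℤ) :
    genSeries (starting c) α =
      X ^ (α 0).toNat * genSeries (admissible S) (α - c.root) := by
  rw [starting_eq_image h1 h2, genSeries_image_cons_shift]

theorem genSeries_starting_c2 (α : Fin 4 → ℤ) :
    genSeries (starting c2) α =
      X ^ (α 0).toNat * genSeries (admissible {c2}ᶜ) (α - c2.root) +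
        X * genSeries (starting u2) (α - c2.root) := by
  have hdis : Disjoint ((fun x => (c2, 1) :: shift x) '' admissible {c2}ᶜ)
      ((List.cons (c2, 1)) '' starting u2) := by
    rw [← Set.image_image (List.cons (c2, 1)) shift,
      Set.disjoint_image_iff List.cons_injective, image_shift_admissible, Set.disjoint_left]
    intro x hx hx'
    -- A head of degree 1 contradicts a head of degree at least 2.
    have := hx.2 _ (mem_starting.1 hx').2
    simp at this
  have hsub := starting_subset c2
  rw [starting_c2] at hsub
  rw [starting_c2, genSeries_union hdis
    (graded_finite_of_subset (Set.subset_union_left.trans hsub) α)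
    (graded_finite_of_subset (Set.subset_union_right.trans hsub) α), genSeries_image_cons_shift]
  congr 1
  rw [← pow_one (X : ℚ⟦X⟧)]
  refine genSeries_image List.cons_injective (fun x _ => ?_) fun x _ _ => ?_
  · rw [weight_cons, eq_sub_iff_add_eq, add_comm]
  · rw [degree_cons, add_comm]

theorem genSeries_of_neg {B : Set Mon} {α : Fin 4 → ℤ} (h : α 0 < 0) : genSeries B α = 0 := by
  ext d
  have : graded B α d = ∅ := by
    refine Set.eq_empty_of_forall_notMem ?_
    rintro x ⟨-, rfl, -⟩
    rw [weight_zero] at h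
    omega
  simp [genSeries, this]

theorem genSeries_of_zero {S : Set Color} {α : Fin 4 → ℤ} (h : α 0 = 0) :
    genSeries (admissible S) α = if α = 0 then 1 else 0 := by
  have hnil : ∀ x : Mon, weight x = α → x = [] := by
    rintro x rfl
    rw [weight_zero] at h
    exact List.length_eq_zero_iff.1 (by exact_mod_cast h)
  ext d
  have e : graded (admissible S) α d = if α = 0 ∧ d = 0 then {[]} else ∅ := by
    ext x
    constructor
    · rintro ⟨-, h1, h2⟩
      obtain rfl := hnil x h1
      simp only [weight, degree, List.map_nil, List.sum_nil] at h1 h2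
      rw [if_pos ⟨h1.symm, h2.symm⟩]
      rfl
    · split_ifs with hd
      · rintro rfl
        refine ⟨?_, ?_, ?_⟩
        · rw [admissible_eq_region]
          exact nil_mem_region
        · simp [weight, hd.1]
        · simp [degree, hd.2]
      · simp
  simp only [genSeries, coeff_mk, e]
  by_cases h1 : α = 0 <;> by_cases h2 : d = 0 <;> simp [h1, h2, coeff_one]

end Monomials

/-! ### The summands over a field, for arbitrary integer weights -/

section QIdentities

variable {K : Type*} [Field K] (q : K)

/-- `(q)_n` in a field, for `n ≥ 0`. -/
def qPoch (n : ℤ) : K := ∏ j ∈ Finset.range n.toNat, (1 - q ^ (j + 1))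

/-- `1 / (q)_n`, with the convention that it vanishes for `n < 0`. -/
def qPochInv (n : ℤ) : K := if n < 0 then 0 else (qPoch q n)⁻¹

theorem qPoch_step {n : ℤ} (hn : 0 < n) : qPoch q n = (1 - q ^ n) * qPoch q (n - 1) := by
  obtain ⟨m, rfl⟩ : ∃ m : ℕ, n = m + 1 := ⟨(n - 1).toNat, by omega⟩
  have h1 : ((m : ℤ) + 1).toNat = m + 1 := by omega
  have h2 : ((m : ℤ) + 1 - 1).toNat = m := by omega
  rw [qPoch, qPoch, h1, h2, Finset.prod_range_succ, mul_comm]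
  norm_cast

theorem qPochInv_of_neg {n : ℤ} (hn : n < 0) : qPochInv q n = 0 := if_pos hn

theorem qPochInv_of_nonneg {n : ℤ} (hn : 0 ≤ n) : qPochInv q n = (qPoch q n)⁻¹ :=
  if_neg (not_lt.2 hn)

variable {q}

/-- The vanishing convention makes this hold for every integer: at `n = 0` both sides are 0 because
`1 - q ^ 0 = 0`. No boundary cases are then needed for the denominators. -/
theorem qPochInv_step (hq : ∀ n : ℤ, n ≠ 0 → q ^ n ≠ 1) (n : ℤ) :
    qPochInv q (n - 1) = (1 - q ^ n) * qPochInv q n := by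
  rcases lt_trichotomy n 0 with hn | rfl | hn
  · rw [qPochInv_of_neg q hn, qPochInv_of_neg q (by omega), mul_zero]
  · rw [qPochInv_of_neg q (by omega)]
    simp
  · have h : 1 - q ^ n ≠ 0 := sub_ne_zero.2 (hq n hn.ne').symm
    rw [qPochInv_of_nonneg q hn.le, qPochInv_of_nonneg q (by omega), qPoch_step q hn, mul_inv,
      mul_inv_cancel_left₀ h]

variable (q)

/-- The summand of the character formula in a field, extended by zero to all `j`. -/
def term (n₁ n₂ n₃ n₄ j : ℤ) : K :=
  q ^ f n₁ n₂ n₃ n₄ j * qPoch q (n₁ - n₂ + n₃ - n₄ + 2 * j) *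
    (qPochInv q (n₃ - n₄ + j) * qPochInv q (n₁ - n₂ + j) * qPochInv q j *
      qPochInv q (n₁ - n₂ + n₃ - n₄ + j) * qPochInv q (n₄ - j) * qPochInv q (n₂ - n₃ - j))

/-- The factor `ρ` in a field; its value at a vanishing denominator is `0`. -/
def rho (n₁ n₂ n₃ n₄ j : ℤ) : K :=
  (1 - q ^ (n₃ - n₄ + j)) * (1 - q ^ j) / (1 - q ^ (n₁ - n₂ + n₃ - n₄ + 2 * j))

/-- The factor `d_γ` in a field. -/
def coef (γ : Option Color) (n₁ n₂ n₃ n₄ j : ℤ) : K :=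
  match γ with
  | some c2 => 1
  | some c3 => 1 - rho q n₁ n₂ n₃ n₄ j
  | some c4 => q ^ n₃
  | some u4 => q ^ n₄
  | some u3 => q ^ (n₃ + j) + q ^ (n₁ - n₂ + n₃ + j) * rho q n₁ n₂ n₃ n₄ j
  | some u2 => q ^ n₂ + q ^ n₁ * rho q n₁ n₂ n₃ n₄ j
  | none => q ^ n₁

/-- The right-hand side of the character formula in a field, for arbitrary weights. -/
def fieldFormula (γ : Option Color) (n₁ n₂ n₃ n₄ : ℤ) : K :=
  ∑ j ∈ Finset.Icc (0 : ℤ) n₄, coef q γ n₁ n₂ n₃ n₄ j * term q n₁ n₂ n₃ n₄ j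

variable {q}

theorem nonneg_of_term_ne_zero {n₁ n₂ n₃ n₄ j : ℤ} (h : term q n₁ n₂ n₃ n₄ j ≠ 0) :
    0 ≤ n₃ - n₄ + j ∧ 0 ≤ n₁ - n₂ + j ∧ 0 ≤ j ∧ 0 ≤ n₁ - n₂ + n₃ - n₄ + j ∧
      0 ≤ n₄ - j ∧ 0 ≤ n₂ - n₃ - j := by
  refine ⟨?_, ?_, ?_, ?_, ?_, ?_⟩ <;> by_contra hn <;> apply h <;>
    simp [term, qPochInv_of_neg q (not_le.1 hn)]

/-- The index `N = n₁ - n₂ + n₃ - n₄ + 2j` of the numerator is the sum of two denominator indices,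
and also `j` plus a third. On the support all of these are nonnegative, so `N ≤ 0` forces them to
vanish. This isolates the only weights where `rho` is `0 / 0`. -/
theorem term_eq_zero_or_of_nonpos {n₁ n₂ n₃ n₄ j : ℤ} (hN : ¬0 < n₁ - n₂ + n₃ - n₄ + 2 * j) :
    term q n₁ n₂ n₃ n₄ j = 0 ∨ (n₁ = n₂ ∧ n₃ = n₄ ∧ j = 0) := by
  by_cases h : term q n₁ n₂ n₃ n₄ j = 0
  · exact Or.inl h
  · obtain ⟨h1, h2, h3, h4, h5, h6⟩ := nonneg_of_term_ne_zero h
    exact Or.inr ⟨by omega, by omega, by omega⟩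

/-- The support in `j` lies in `[0, n₄]`; enlarging the range lets sums for different weights be
compared term by term. -/
theorem fieldFormula_eq_sum (γ : Option Color) (n₁ n₂ n₃ n₄ : ℤ) {M : ℤ} (hM : n₄ ≤ M) :
    fieldFormula q γ n₁ n₂ n₃ n₄ =
      ∑ j ∈ Finset.Icc (0 : ℤ) M, coef q γ n₁ n₂ n₃ n₄ j * term q n₁ n₂ n₃ n₄ j := by
  refine Finset.sum_subset (Finset.Icc_subset_Icc le_rfl hM) fun j _ hj => ?_
  by_contra h
  have := nonneg_of_term_ne_zero (right_ne_zero_of_mul h)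
  exact hj (Finset.mem_Icc.2 ⟨by omega, by omega⟩)

/-- The substitution `j ↦ j - 1` matches the shift of `j` in `term_sub_c4` and `term_sub_c2`. -/
theorem fieldFormula_eq_sum_shift (γ : Option Color) (n₁ n₂ n₃ n₄ : ℤ) {M : ℤ}
    (hM : n₄ + 1 ≤ M) :
    fieldFormula q γ n₁ n₂ n₃ n₄ =
      ∑ j ∈ Finset.Icc (0 : ℤ) M,
        coef q γ n₁ n₂ n₃ n₄ (j - 1) * term q n₁ n₂ n₃ n₄ (j - 1) := by
  have h1 : fieldFormula q γ n₁ n₂ n₃ n₄ = ∑ j ∈ Finset.Icc (1 : ℤ) (n₄ + 1),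
      coef q γ n₁ n₂ n₃ n₄ (j - 1) * term q n₁ n₂ n₃ n₄ (j - 1) := by
    refine Finset.sum_bij' (fun j _ => j + 1) (fun j _ => j - 1) ?_ ?_ ?_ ?_ ?_ <;>
      simp only [Finset.mem_Icc, add_sub_cancel_right, sub_add_cancel, implies_true] <;>
      intro j hj <;> omega
  rw [h1]
  refine Finset.sum_subset (Finset.Icc_subset_Icc zero_le_one hM) fun j _ hj => ?_
  by_contra h
  have := nonneg_of_term_ne_zero (right_ne_zero_of_mul h)
  exact hj (Finset.mem_Icc.2 ⟨by omega, by omega⟩)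

/-! ### Effect on a summand of subtracting a color from the weight -/

/-- Here `N` and two denominator indices drop by one, so the quotient of summands is a power of `q`
times `(1 - q^{n₁-n₂+j})(1 - q^{n₁-n₂+n₃-n₄+j}) / (1 - q^N)`, which is linear in `rho`. The bracket
on the right is `d_{u2} - d_0`. -/
theorem term_sub_u2 (hq0 : q ≠ 0) (hq : ∀ n : ℤ, n ≠ 0 → q ^ n ≠ 1)
    (n₁ n₂ n₃ n₄ j : ℤ) :
    q ^ (2 * n₁ - 1) * term q (n₁ - 1) n₂ n₃ n₄ j =
      (q ^ n₂ - q ^ n₁ + q ^ n₁ * rho q n₁ n₂ n₃ n₄ j) * term q n₁ n₂ n₃ n₄ j := by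
  by_cases hN : 0 < n₁ - n₂ + n₃ - n₄ + 2 * j
  · have hN1 : 1 - q ^ (n₁ - n₂ + n₃ - n₄ + 2 * j) ≠ 0 := sub_ne_zero.2 (hq _ hN.ne').symm
    have e : q ^ f (n₁ - 1) n₂ n₃ n₄ j = q ^ f n₁ n₂ n₃ n₄ j * q ^ (-n₁ - n₁ + 1 + n₂) := by
      rw [← zpow_add₀ hq0]; congr 1; unfold f; ring
    have iN : n₁ - 1 - n₂ + n₃ - n₄ + 2 * j = n₁ - n₂ + n₃ - n₄ + 2 * j - 1 := by ring
    have iB : n₁ - 1 - n₂ + j = n₁ - n₂ + j - 1 := by ring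
    have iC : n₁ - 1 - n₂ + n₃ - n₄ + j = n₁ - n₂ + n₃ - n₄ + j - 1 := by ring
    rw [term, term, e, iN, iB, iC,
      qPochInv_step hq (n₁ - n₂ + j),
      qPochInv_step hq (n₁ - n₂ + n₃ - n₄ + j), qPoch_step q hN]
    have hr : rho q n₁ n₂ n₃ n₄ j * (1 - q ^ (n₁ - n₂ + n₃ - n₄ + 2 * j)) =
        (1 - q ^ (n₃ - n₄ + j)) * (1 - q ^ j) := div_mul_cancel₀ _ hN1
    generalize rho q n₁ n₂ n₃ n₄ j = r at hr ⊢
    generalize q ^ f n₁ n₂ n₃ n₄ j = x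
    generalize qPoch q (n₁ - n₂ + n₃ - n₄ + 2 * j - 1) = g
    have hk : q ^ (2 * n₁ - 1) * q ^ (-n₁ - n₁ + 1 + n₂) = q ^ n₂ := by
      rw [← zpow_add₀ hq0]
      congr 1
      ring
    have z1 : q ^ n₁ = q ^ n₂ * q ^ (n₁ - n₂) := by
      simp only [← zpow_add₀ hq0]
      congr 1
      ring
    have zA : q ^ (n₃ - n₄ + j) = q ^ (n₃ - n₄) * q ^ j := by
      simp only [← zpow_add₀ hq0]
    have zB : q ^ (n₁ - n₂ + j) = q ^ (n₁ - n₂) * q ^ j := by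
      simp only [← zpow_add₀ hq0]
    have zC : q ^ (n₁ - n₂ + n₃ - n₄ + j) = q ^ (n₁ - n₂) * q ^ (n₃ - n₄) * q ^ j := by
      simp only [← zpow_add₀ hq0]
      congr 1
      ring
    have zN : q ^ (n₁ - n₂ + n₃ - n₄ + 2 * j) = q ^ (n₁ - n₂) * q ^ (n₃ - n₄) * q ^ j * q ^ j := by
      simp only [← zpow_add₀ hq0]
      congr 1
      ring
    -- With `1 - q^N` cleared, this is a polynomial identity in powers of `q` modulo the defining
    -- relation `hr` of `rho`.
    have core : q ^ (2 * n₁ - 1) * q ^ (-n₁ - n₁ + 1 + n₂) * ((1 - q ^ (n₁ - n₂ + j)) * (1 -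
        q ^ (n₁ - n₂ + n₃ - n₄ + j))) =
        (q ^ n₂ - q ^ n₁ + q ^ n₁ * r) * (1 - q ^ (n₁ - n₂ + n₃ - n₄ + 2 * j)) := by
      rw [hk]
      simp only [z1, zA, zB, zC, zN] at hr ⊢
      linear_combination (-(q ^ n₂ * q ^ (n₁ - n₂))) * hr
    linear_combination (x * g * (qPochInv q (n₃ - n₄ + j) * qPochInv q (n₁ - n₂ + j) *
        qPochInv q j * qPochInv q (n₁ - n₂ + n₃ - n₄ + j) * qPochInv q (n₄ - j) *
        qPochInv q (n₂ - n₃ - j))) * core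
  -- The numerator index on the left is `N - 1 < 0`, which is outside the support.
  · have h0 : term q (n₁ - 1) n₂ n₃ n₄ j = 0 := by
      by_contra h
      have := nonneg_of_term_ne_zero h
      omega
    rw [h0, mul_zero]
    rcases term_eq_zero_or_of_nonpos (q := q) hN with h | ⟨rfl, rfl, rfl⟩
    · rw [h, mul_zero]
    · simp [rho]

/-- Only the index `n₂ - n₃ - j` changes, so `rho` does not appear. -/
theorem term_sub_u3 (hq0 : q ≠ 0) (hq : ∀ n : ℤ, n ≠ 0 → q ^ n ≠ 1)
    (n₁ n₂ n₃ n₄ j : ℤ) :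
    q ^ (n₁ + n₂ - 1) * term q (n₁ - 1) (n₂ - 1) n₃ n₄ j =
      (q ^ (n₃ + j) - q ^ n₂) * term q n₁ n₂ n₃ n₄ j := by
  have e : q ^ f (n₁ - 1) (n₂ - 1) n₃ n₄ j = q ^ f n₁ n₂ n₃ n₄ j * q ^ (-n₁ - n₂ + 1 + n₃ + j) := by
    rw [← zpow_add₀ hq0]; congr 1; unfold f; ring
  have iN : n₁ - 1 - (n₂ - 1) + n₃ - n₄ + 2 * j = n₁ - n₂ + n₃ - n₄ + 2 * j := by ring
  have iB : n₁ - 1 - (n₂ - 1) + j = n₁ - n₂ + j := by ring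
  have iC : n₁ - 1 - (n₂ - 1) + n₃ - n₄ + j = n₁ - n₂ + n₃ - n₄ + j := by ring
  have iE : n₂ - 1 - n₃ - j = n₂ - n₃ - j - 1 := by ring
  rw [term, term, e, iN, iB, iC, iE,
    qPochInv_step hq (n₂ - n₃ - j)]
  generalize q ^ f n₁ n₂ n₃ n₄ j = x
  generalize qPoch q (n₁ - n₂ + n₃ - n₄ + 2 * j) = g
  simp only [zpow_add₀ hq0, zpow_sub₀ hq0, zpow_neg, zpow_one]
  field_simp

theorem term_sub_u4 (hq0 : q ≠ 0) (hq : ∀ n : ℤ, n ≠ 0 → q ^ n ≠ 1)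
    (n₁ n₂ n₃ n₄ j : ℤ) :
    q ^ (n₁ + n₃ - 1) * term q (n₁ - 1) (n₂ - 1) (n₃ - 1) n₄ j =
      (q ^ n₄ - q ^ (n₃ + j) - q ^ (n₁ - n₂ + n₃ + j) * rho q n₁ n₂ n₃ n₄ j) *
          term q n₁ n₂ n₃ n₄ j := by
  by_cases hN : 0 < n₁ - n₂ + n₃ - n₄ + 2 * j
  · have hN1 : 1 - q ^ (n₁ - n₂ + n₃ - n₄ + 2 * j) ≠ 0 := sub_ne_zero.2 (hq _ hN.ne').symm
    have e : q ^ f (n₁ - 1) (n₂ - 1) (n₃ - 1) n₄ j = q ^ f n₁ n₂ n₃ n₄ j * q ^ (-n₁ -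
        n₃ + n₄ + 1) := by
      rw [← zpow_add₀ hq0]; congr 1; unfold f; ring
    have iN : n₁ - 1 - (n₂ - 1) + (n₃ - 1) - n₄ + 2 * j = n₁ - n₂ + n₃ - n₄ + 2 * j - 1 := by ring
    have iA : n₃ - 1 - n₄ + j = n₃ - n₄ + j - 1 := by ring
    have iB : n₁ - 1 - (n₂ - 1) + j = n₁ - n₂ + j := by ring
    have iC : n₁ - 1 - (n₂ - 1) + (n₃ - 1) - n₄ + j = n₁ - n₂ + n₃ - n₄ + j - 1 := by ring
    have iE : n₂ - 1 - (n₃ - 1) - j = n₂ - n₃ - j := by ring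
    rw [term, term, e, iN, iA, iB, iC, iE,
      qPochInv_step hq (n₃ - n₄ + j),
      qPochInv_step hq (n₁ - n₂ + n₃ - n₄ + j), qPoch_step q hN]
    have hr : rho q n₁ n₂ n₃ n₄ j * (1 - q ^ (n₁ - n₂ + n₃ - n₄ + 2 * j)) =
        (1 - q ^ (n₃ - n₄ + j)) * (1 - q ^ j) := div_mul_cancel₀ _ hN1
    generalize rho q n₁ n₂ n₃ n₄ j = r at hr ⊢
    generalize q ^ f n₁ n₂ n₃ n₄ j = x
    generalize qPoch q (n₁ - n₂ + n₃ - n₄ + 2 * j - 1) = g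
    have hk : q ^ (n₁ + n₃ - 1) * q ^ (-n₁ - n₃ + n₄ + 1) = q ^ n₄ := by
      rw [← zpow_add₀ hq0]
      congr 1
      ring
    have z3 : q ^ (n₃ + j) = q ^ n₄ * q ^ (n₃ - n₄) * q ^ j := by
      simp only [← zpow_add₀ hq0]
      congr 1
      ring
    have z4 : q ^ (n₁ - n₂ + n₃ + j) = q ^ (n₁ - n₂) * q ^ n₄ * q ^ (n₃ - n₄) * q ^ j := by
      simp only [← zpow_add₀ hq0]
      congr 1
      ring
    have zA : q ^ (n₃ - n₄ + j) = q ^ (n₃ - n₄) * q ^ j := by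
      simp only [← zpow_add₀ hq0]
    have zC : q ^ (n₁ - n₂ + n₃ - n₄ + j) = q ^ (n₁ - n₂) * q ^ (n₃ - n₄) * q ^ j := by
      simp only [← zpow_add₀ hq0]
      congr 1
      ring
    have zN : q ^ (n₁ - n₂ + n₃ - n₄ + 2 * j) = q ^ (n₁ - n₂) * q ^ (n₃ - n₄) * q ^ j * q ^ j := by
      simp only [← zpow_add₀ hq0]
      congr 1
      ring
    have core : q ^ (n₁ + n₃ - 1) * q ^ (-n₁ - n₃ + n₄ + 1) * ((1 - q ^ (n₃ - n₄ + j)) * (1 -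
        q ^ (n₁ - n₂ + n₃ - n₄ + j))) =
        (q ^ n₄ - q ^ (n₃ + j) - q ^ (n₁ - n₂ + n₃ + j) * r) * (1 - q ^ (n₁ - n₂ + n₃ - n₄ + 2 *
            j)) := by
      rw [hk]
      simp only [z3, z4, zA, zC, zN] at hr ⊢
      linear_combination (q ^ (n₁ - n₂) * q ^ n₄ * q ^ (n₃ - n₄) * q ^ j) * hr
    linear_combination (x * g * (qPochInv q (n₃ - n₄ + j) * qPochInv q (n₁ - n₂ + j) *
        qPochInv q j * qPochInv q (n₁ - n₂ + n₃ - n₄ + j) * qPochInv q (n₄ - j) *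
        qPochInv q (n₂ - n₃ - j))) * core
  · have h0 : term q (n₁ - 1) (n₂ - 1) (n₃ - 1) n₄ j = 0 := by
      by_contra h
      have := nonneg_of_term_ne_zero h
      omega
    rw [h0, mul_zero]
    rcases term_eq_zero_or_of_nonpos (q := q) hN with h | ⟨rfl, rfl, rfl⟩
    · rw [h, mul_zero]
    · simp [rho]

/-- Lowering `j` together with `n₄` keeps `n₄ - j` fixed; the denominator indices that drop are `n₁
- n₂ + j` and `j`. The bracket is `d_{c4} - d_{u3}`. -/
theorem term_sub_c4 (hq0 : q ≠ 0) (hq : ∀ n : ℤ, n ≠ 0 → q ^ n ≠ 1)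
    (n₁ n₂ n₃ n₄ j : ℤ) :
    q ^ (n₁ + n₄ - 1) * term q (n₁ - 1) (n₂ - 1) n₃ (n₄ - 1) (j - 1) =
      (q ^ n₃ - q ^ (n₃ + j) - q ^ (n₁ - n₂ + n₃ + j) * rho q n₁ n₂ n₃ n₄ j) *
          term q n₁ n₂ n₃ n₄ j := by
  by_cases hN : 0 < n₁ - n₂ + n₃ - n₄ + 2 * j
  · have hN1 : 1 - q ^ (n₁ - n₂ + n₃ - n₄ + 2 * j) ≠ 0 := sub_ne_zero.2 (hq _ hN.ne').symm
    have e : q ^ f (n₁ - 1) (n₂ - 1) n₃ (n₄ - 1) (j - 1) = q ^ f n₁ n₂ n₃ n₄ j * q ^ (-n₁ + n₃ -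
        n₄ + 1) := by
      rw [← zpow_add₀ hq0]; congr 1; unfold f; ring
    have iN : n₁ - 1 - (n₂ - 1) + n₃ - (n₄ - 1) + 2 * (j - 1) = n₁ - n₂ + n₃ - n₄ + 2 * j -
        1 := by ring
    have iA : n₃ - (n₄ - 1) + (j - 1) = n₃ - n₄ + j := by ring
    have iB : n₁ - 1 - (n₂ - 1) + (j - 1) = n₁ - n₂ + j - 1 := by ring
    have iC : n₁ - 1 - (n₂ - 1) + n₃ - (n₄ - 1) + (j - 1) = n₁ - n₂ + n₃ - n₄ + j := by ring
    have iD : n₄ - 1 - (j - 1) = n₄ - j := by ring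
    have iE : n₂ - 1 - n₃ - (j - 1) = n₂ - n₃ - j := by ring
    rw [term, term, e, iN, iA, iB, iC, iD, iE,
      qPochInv_step hq (n₁ - n₂ + j),
      qPochInv_step hq j, qPoch_step q hN]
    have hr : rho q n₁ n₂ n₃ n₄ j * (1 - q ^ (n₁ - n₂ + n₃ - n₄ + 2 * j)) =
        (1 - q ^ (n₃ - n₄ + j)) * (1 - q ^ j) := div_mul_cancel₀ _ hN1
    generalize rho q n₁ n₂ n₃ n₄ j = r at hr ⊢
    generalize q ^ f n₁ n₂ n₃ n₄ j = x
    generalize qPoch q (n₁ - n₂ + n₃ - n₄ + 2 * j - 1) = g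
    have hk : q ^ (n₁ + n₄ - 1) * q ^ (-n₁ + n₃ - n₄ + 1) = q ^ n₃ := by
      rw [← zpow_add₀ hq0]
      congr 1
      ring
    have z2 : q ^ n₃ = q ^ n₄ * q ^ (n₃ - n₄) := by
      simp only [← zpow_add₀ hq0]
      congr 1
      ring
    have z3 : q ^ (n₃ + j) = q ^ n₄ * q ^ (n₃ - n₄) * q ^ j := by
      simp only [← zpow_add₀ hq0]
      congr 1
      ring
    have z4 : q ^ (n₁ - n₂ + n₃ + j) = q ^ (n₁ - n₂) * q ^ n₄ * q ^ (n₃ - n₄) * q ^ j := by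
      simp only [← zpow_add₀ hq0]
      congr 1
      ring
    have zA : q ^ (n₃ - n₄ + j) = q ^ (n₃ - n₄) * q ^ j := by
      simp only [← zpow_add₀ hq0]
    have zB : q ^ (n₁ - n₂ + j) = q ^ (n₁ - n₂) * q ^ j := by
      simp only [← zpow_add₀ hq0]
    have zN : q ^ (n₁ - n₂ + n₃ - n₄ + 2 * j) = q ^ (n₁ - n₂) * q ^ (n₃ - n₄) * q ^ j * q ^ j := by
      simp only [← zpow_add₀ hq0]
      congr 1
      ring
    have core : q ^ (n₁ + n₄ - 1) * q ^ (-n₁ + n₃ - n₄ + 1) * ((1 - q ^ (n₁ - n₂ + j)) * (1 -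
        q ^ j)) =
        (q ^ n₃ - q ^ (n₃ + j) - q ^ (n₁ - n₂ + n₃ + j) * r) * (1 - q ^ (n₁ - n₂ + n₃ - n₄ + 2 *
            j)) := by
      rw [hk]
      simp only [z2, z3, z4, zA, zB, zN] at hr ⊢
      linear_combination (q ^ (n₁ - n₂) * q ^ n₄ * q ^ (n₃ - n₄) * q ^ j) * hr
    linear_combination (x * g * (qPochInv q (n₃ - n₄ + j) * qPochInv q (n₁ - n₂ + j) *
        qPochInv q j * qPochInv q (n₁ - n₂ + n₃ - n₄ + j) * qPochInv q (n₄ - j) *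
        qPochInv q (n₂ - n₃ - j))) * core
  · have h0 : term q (n₁ - 1) (n₂ - 1) n₃ (n₄ - 1) (j - 1) = 0 := by
      by_contra h
      have := nonneg_of_term_ne_zero h
      omega
    rw [h0, mul_zero]
    rcases term_eq_zero_or_of_nonpos (q := q) hN with h | ⟨rfl, rfl, rfl⟩
    · rw [h, mul_zero]
    · simp [rho]

theorem term_sub_c3 (hq0 : q ≠ 0) (hq : ∀ n : ℤ, n ≠ 0 → q ^ n ≠ 1)
    (n₁ n₂ n₃ n₄ j : ℤ) :
    q ^ (n₁ + n₄ - 1) * term q (n₁ - 1) (n₂ - 1) (n₃ - 1) (n₄ - 1) j =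
      (q ^ j - q ^ n₄) * term q n₁ n₂ n₃ n₄ j := by
  have e : q ^ f (n₁ - 1) (n₂ - 1) (n₃ - 1) (n₄ - 1) j = q ^ f n₁ n₂ n₃ n₄ j * q ^ (-n₁ -
      n₄ + 1 + j) := by
    rw [← zpow_add₀ hq0]; congr 1; unfold f; ring
  have iN : n₁ - 1 - (n₂ - 1) + (n₃ - 1) - (n₄ - 1) + 2 * j = n₁ - n₂ + n₃ - n₄ + 2 * j := by ring
  have iA : n₃ - 1 - (n₄ - 1) + j = n₃ - n₄ + j := by ring
  have iB : n₁ - 1 - (n₂ - 1) + j = n₁ - n₂ + j := by ring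
  have iC : n₁ - 1 - (n₂ - 1) + (n₃ - 1) - (n₄ - 1) + j = n₁ - n₂ + n₃ - n₄ + j := by ring
  have iD : n₄ - 1 - j = n₄ - j - 1 := by ring
  have iE : n₂ - 1 - (n₃ - 1) - j = n₂ - n₃ - j := by ring
  rw [term, term, e, iN, iA, iB, iC, iD, iE,
    qPochInv_step hq (n₄ - j)]
  generalize q ^ f n₁ n₂ n₃ n₄ j = x
  generalize qPoch q (n₁ - n₂ + n₃ - n₄ + 2 * j) = g
  simp only [zpow_add₀ hq0, zpow_sub₀ hq0, zpow_neg, zpow_one]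
  field_simp

/-- With `j` lowered, the denominator indices that drop are `n₃ - n₄ + j` and `j`, so the quotient
of summands is `rho` itself up to a power of `q`. This is the origin of `rho`. -/
theorem term_sub_c2 (hq0 : q ≠ 0) (hq : ∀ n : ℤ, n ≠ 0 → q ^ n ≠ 1)
    (n₁ n₂ n₃ n₄ j : ℤ) :
    q ^ (n₂ - 1) * term q (n₁ - 1) (n₂ - 2) (n₃ - 1) (n₄ - 1) (j - 1) =
      (rho q n₁ n₂ n₃ n₄ j) * term q n₁ n₂ n₃ n₄ j := by
  by_cases hN : 0 < n₁ - n₂ + n₃ - n₄ + 2 * j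
  · have hN1 : 1 - q ^ (n₁ - n₂ + n₃ - n₄ + 2 * j) ≠ 0 := sub_ne_zero.2 (hq _ hN.ne').symm
    have e : q ^ f (n₁ - 1) (n₂ - 2) (n₃ - 1) (n₄ - 1) (j - 1) = q ^ f n₁ n₂ n₃ n₄ j *
        q ^ (-n₂ + 1) := by
      rw [← zpow_add₀ hq0]; congr 1; unfold f; ring
    have iN : n₁ - 1 - (n₂ - 2) + (n₃ - 1) - (n₄ - 1) + 2 * (j - 1) = n₁ - n₂ + n₃ - n₄ + 2 * j -
        1 := by ring
    have iA : n₃ - 1 - (n₄ - 1) + (j - 1) = n₃ - n₄ + j - 1 := by ring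
    have iB : n₁ - 1 - (n₂ - 2) + (j - 1) = n₁ - n₂ + j := by ring
    have iC : n₁ - 1 - (n₂ - 2) + (n₃ - 1) - (n₄ - 1) + (j - 1) = n₁ - n₂ + n₃ - n₄ + j := by ring
    have iD : n₄ - 1 - (j - 1) = n₄ - j := by ring
    have iE : n₂ - 2 - (n₃ - 1) - (j - 1) = n₂ - n₃ - j := by ring
    rw [term, term, e, iN, iA, iB, iC, iD, iE,
      qPochInv_step hq (n₃ - n₄ + j),
      qPochInv_step hq j, qPoch_step q hN]
    have hr : rho q n₁ n₂ n₃ n₄ j * (1 - q ^ (n₁ - n₂ + n₃ - n₄ + 2 * j)) =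
        (1 - q ^ (n₃ - n₄ + j)) * (1 - q ^ j) := div_mul_cancel₀ _ hN1
    generalize rho q n₁ n₂ n₃ n₄ j = r at hr ⊢
    generalize q ^ f n₁ n₂ n₃ n₄ j = x
    generalize qPoch q (n₁ - n₂ + n₃ - n₄ + 2 * j - 1) = g
    have hk : q ^ (n₂ - 1) * q ^ (-n₂ + 1) = 1 := by
      rw [← zpow_add₀ hq0]
      ring_nf
      exact zpow_zero q
    have zA : q ^ (n₃ - n₄ + j) = q ^ (n₃ - n₄) * q ^ j := by
      simp only [← zpow_add₀ hq0]
    have zN : q ^ (n₁ - n₂ + n₃ - n₄ + 2 * j) = q ^ (n₁ - n₂) * q ^ (n₃ - n₄) * q ^ j * q ^ j := by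
      simp only [← zpow_add₀ hq0]
      congr 1
      ring
    have core : q ^ (n₂ - 1) * q ^ (-n₂ + 1) * ((1 - q ^ (n₃ - n₄ + j)) * (1 - q ^ j)) =
        (r) * (1 - q ^ (n₁ - n₂ + n₃ - n₄ + 2 * j)) := by
      rw [hk]
      simp only [zA, zN] at hr ⊢
      linear_combination (-1) * hr
    linear_combination (x * g * (qPochInv q (n₃ - n₄ + j) * qPochInv q (n₁ - n₂ + j) *
        qPochInv q j * qPochInv q (n₁ - n₂ + n₃ - n₄ + j) * qPochInv q (n₄ - j) *
        qPochInv q (n₂ - n₃ - j))) * core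
  · have h0 : term q (n₁ - 1) (n₂ - 2) (n₃ - 1) (n₄ - 1) (j - 1) = 0 := by
      by_contra h
      have := nonneg_of_term_ne_zero h
      omega
    rw [h0, mul_zero]
    rcases term_eq_zero_or_of_nonpos (q := q) hN with h | ⟨rfl, rfl, rfl⟩
    · rw [h, mul_zero]
    · simp [rho]

/-! ### The recursive system: uniqueness and the explicit solution -/

/-- The recursive system of `q`-difference equations which determines the characters. -/
structure CharSystem (q : K) (C : Option Color → ℤ → ℤ → ℤ → ℤ → K) : Prop where
  neg : ∀ γ n₁ n₂ n₃ n₄, n₁ < 0 → C γ n₁ n₂ n₃ n₄ = 0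
  zero : ∀ γ n₂ n₃ n₄, C γ 0 n₂ n₃ n₄ = if n₂ = 0 ∧ n₃ = 0 ∧ n₄ = 0 then 1 else 0
  eq_none : ∀ n₁ n₂ n₃ n₄, 0 < n₁ → C none n₁ n₂ n₃ n₄ = q ^ n₁ * C (some c2) n₁ n₂ n₃ n₄
  eq_u2 : ∀ n₁ n₂ n₃ n₄, 0 < n₁ → C (some u2) n₁ n₂ n₃ n₄ =
    C none n₁ n₂ n₃ n₄ + q ^ n₁ * C none (n₁ - 1) n₂ n₃ n₄
  eq_u3 : ∀ n₁ n₂ n₃ n₄, 0 < n₁ → C (some u3) n₁ n₂ n₃ n₄ =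
    C (some u2) n₁ n₂ n₃ n₄ + q ^ n₁ * C (some u2) (n₁ - 1) (n₂ - 1) n₃ n₄
  eq_u4 : ∀ n₁ n₂ n₃ n₄, 0 < n₁ → C (some u4) n₁ n₂ n₃ n₄ =
    C (some u3) n₁ n₂ n₃ n₄ + q ^ n₁ * C (some c4) (n₁ - 1) (n₂ - 1) (n₃ - 1) n₄
  eq_c4 : ∀ n₁ n₂ n₃ n₄, 0 < n₁ → C (some c4) n₁ n₂ n₃ n₄ =
    C (some u3) n₁ n₂ n₃ n₄ + q ^ n₁ * C (some u4) (n₁ - 1) (n₂ - 1) n₃ (n₄ - 1)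
  eq_c3 : ∀ n₁ n₂ n₃ n₄, 0 < n₁ → C (some c3) n₁ n₂ n₃ n₄ =
    C (some u4) n₁ n₂ n₃ n₄ + C (some c4) n₁ n₂ n₃ n₄ - C (some u3) n₁ n₂ n₃ n₄ +
      q ^ n₁ * (C (some u4) (n₁ - 1) (n₂ - 1) (n₃ - 1) (n₄ - 1) +
        C (some c4) (n₁ - 1) (n₂ - 1) (n₃ - 1) (n₄ - 1) -
        C (some u3) (n₁ - 1) (n₂ - 1) (n₃ - 1) (n₄ - 1))
  eq_c2 : ∀ n₁ n₂ n₃ n₄, 0 < n₁ → C (some c2) n₁ n₂ n₃ n₄ =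
    C (some c3) n₁ n₂ n₃ n₄ + q ^ n₁ * C (some c3) (n₁ - 1) (n₂ - 2) (n₃ - 1) (n₄ - 1) +
      q * (C (some u2) (n₁ - 1) (n₂ - 2) (n₃ - 1) (n₄ - 1) -
        C none (n₁ - 1) (n₂ - 2) (n₃ - 1) (n₄ - 1))

theorem CharSystem.unique (hq : ∀ n : ℤ, n ≠ 0 → q ^ n ≠ 1)
    {C D : Option Color → ℤ → ℤ → ℤ → ℤ → K} (hC : CharSystem q C) (hD : CharSystem q D)
    (γ : Option Color) (n₁ n₂ n₃ n₄ : ℤ) : C γ n₁ n₂ n₃ n₄ = D γ n₁ n₂ n₃ n₄ := by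
  have key : ∀ N : ℕ, ∀ γ n₁ n₂ n₃ n₄, n₁ < (N : ℤ) → C γ n₁ n₂ n₃ n₄ = D γ n₁ n₂ n₃ n₄ := by
    intro N
    induction N with
    | zero =>
      intro γ n₁ n₂ n₃ n₄ h
      rw [hC.neg _ _ _ _ _ (by simpa using h), hD.neg _ _ _ _ _ (by simpa using h)]
    | succ N ih =>
      intro γ n₁ n₂ n₃ n₄ h
      rcases lt_trichotomy n₁ 0 with h0 | rfl | h0
      · rw [hC.neg _ _ _ _ _ h0, hD.neg _ _ _ _ _ h0]
      · rw [hC.zero, hD.zero]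
      have ih' : ∀ γ a b c, C γ (n₁ - 1) a b c = D γ (n₁ - 1) a b c :=
        fun γ a b c => ih γ _ a b c (by push_cast at h; omega)
      have a0 := hC.eq_none n₁ n₂ n₃ n₄ h0
      have a1 := hC.eq_u2 n₁ n₂ n₃ n₄ h0
      have a2 := hC.eq_u3 n₁ n₂ n₃ n₄ h0
      have a3 := hC.eq_u4 n₁ n₂ n₃ n₄ h0
      have a4 := hC.eq_c4 n₁ n₂ n₃ n₄ h0
      have a5 := hC.eq_c3 n₁ n₂ n₃ n₄ h0
      have a6 := hC.eq_c2 n₁ n₂ n₃ n₄ h0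
      simp only [ih'] at a1 a2 a3 a4 a5 a6
      have b0 := hD.eq_none n₁ n₂ n₃ n₄ h0
      have b1 := hD.eq_u2 n₁ n₂ n₃ n₄ h0
      have b2 := hD.eq_u3 n₁ n₂ n₃ n₄ h0
      have b3 := hD.eq_u4 n₁ n₂ n₃ n₄ h0
      have b4 := hD.eq_c4 n₁ n₂ n₃ n₄ h0
      have b5 := hD.eq_c3 n₁ n₂ n₃ n₄ h0
      have b6 := hD.eq_c2 n₁ n₂ n₃ n₄ h0
      -- In the sum of the seven equations all same-weight values cancel except `C c2` and `q ^ n₁ *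
      -- C c2`; `u3` enters twice through `u4` and `c4` and is subtracted once through `c3`.
      have e6 : C (some Color.c2) n₁ n₂ n₃ n₄ = D (some Color.c2) n₁ n₂ n₃ n₄ := by
        have hne : 1 - q ^ n₁ ≠ 0 := sub_ne_zero.2 (hq _ h0.ne').symm
        refine mul_left_cancel₀ hne ?_
        linear_combination a6 + a5 + a3 + a4 + a2 + a1 + a0 -
          (b6 + b5 + b3 + b4 + b2 + b1 + b0)
      have e0 : C none n₁ n₂ n₃ n₄ = D none n₁ n₂ n₃ n₄ := by rw [a0, b0, e6]
      have e1 : C (some Color.u2) n₁ n₂ n₃ n₄ = D (some Color.u2) n₁ n₂ n₃ n₄ := by rw [a1, b1, e0]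
      have e2 : C (some Color.u3) n₁ n₂ n₃ n₄ = D (some Color.u3) n₁ n₂ n₃ n₄ := by rw [a2, b2, e1]
      have e3 : C (some Color.u4) n₁ n₂ n₃ n₄ = D (some Color.u4) n₁ n₂ n₃ n₄ := by rw [a3, b3, e2]
      have e4 : C (some Color.c4) n₁ n₂ n₃ n₄ = D (some Color.c4) n₁ n₂ n₃ n₄ := by rw [a4, b4, e2]
      have e5 : C (some Color.c3) n₁ n₂ n₃ n₄ = D (some Color.c3) n₁ n₂ n₃ n₄ := by
        rw [a5, b5, e2, e3, e4]
      rcases γ with _ | γ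
      · exact e0
      · cases γ <;> assumption
  exact key (n₁.toNat + 1) γ n₁ n₂ n₃ n₄ (by omega)

theorem fieldFormula_system (hq0 : q ≠ 0) (hq : ∀ n : ℤ, n ≠ 0 → q ^ n ≠ 1) :
    CharSystem q (fieldFormula q) where
  neg γ n₁ n₂ n₃ n₄ h := by
    refine Finset.sum_eq_zero fun j _ => ?_
    by_contra h'
    have := nonneg_of_term_ne_zero (right_ne_zero_of_mul h')
    omega
  zero γ n₂ n₃ n₄ := by
    split_ifs with h
    · obtain ⟨rfl, rfl, rfl⟩ := h
      have ht : term q 0 0 0 0 0 = 1 := by simp [term, f, qPoch, qPochInv]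
      rcases γ with _ | γ
      · simp [fieldFormula, ht, coef]
      · cases γ <;> simp [fieldFormula, ht, coef, rho]
    · refine Finset.sum_eq_zero fun j _ => ?_
      by_contra h'
      have := nonneg_of_term_ne_zero (right_ne_zero_of_mul h')
      exact h ⟨by omega, by omega, by omega⟩
  eq_none n₁ n₂ n₃ n₄ _ := by
    simp only [fieldFormula, coef, Finset.mul_sum, one_mul]
  eq_u2 n₁ n₂ n₃ n₄ _ := by
    simp only [fieldFormula, Finset.mul_sum, ← Finset.sum_add_distrib]
    refine Finset.sum_congr rfl fun j _ => ?_
    have ht := term_sub_u2 hq0 hq n₁ n₂ n₃ n₄ j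
    have e : q ^ n₁ * q ^ (n₁ - 1) = q ^ (2 * n₁ - 1) := by
      rw [← zpow_add₀ hq0]; congr 1; ring
    simp only [coef]
    rw [← mul_assoc, e]
    linear_combination -ht
  eq_u3 n₁ n₂ n₃ n₄ _ := by
    simp only [fieldFormula, Finset.mul_sum, ← Finset.sum_add_distrib]
    refine Finset.sum_congr rfl fun j _ => ?_
    have ht := term_sub_u3 hq0 hq n₁ n₂ n₃ n₄ j
    have hr : rho q (n₁ - 1) (n₂ - 1) n₃ n₄ j = rho q n₁ n₂ n₃ n₄ j := by
      simp [rho]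
    have e1 : q ^ n₁ * q ^ (n₂ - 1) = q ^ (n₁ + n₂ - 1) := by
      rw [← zpow_add₀ hq0]; congr 1; ring
    have e2 : q ^ n₁ * q ^ (n₁ - 1) = q ^ (n₁ + n₂ - 1) * q ^ (n₁ - n₂) := by
      rw [← zpow_add₀ hq0, ← zpow_add₀ hq0]; congr 1; ring
    have e3 : q ^ (n₁ - n₂ + n₃ + j) = q ^ (n₃ + j) * q ^ (n₁ - n₂) := by
      rw [← zpow_add₀ hq0]; congr 1; ring
    have e4 : q ^ n₁ = q ^ n₂ * q ^ (n₁ - n₂) := by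
      rw [← zpow_add₀ hq0]; congr 1; ring
    simp only [coef, hr]
    -- `rho` is unchanged by subtracting `u3`, and `1 + q^{n₁-n₂} rho` is a common factor of
    -- `d_{u3}` and `d_{u2}`.
    linear_combination (-(1 + q ^ (n₁ - n₂) * rho q n₁ n₂ n₃ n₄ j)) * ht
      - term q (n₁ - 1) (n₂ - 1) n₃ n₄ j * (e1 + rho q n₁ n₂ n₃ n₄ j * e2)
      + rho q n₁ n₂ n₃ n₄ j * term q n₁ n₂ n₃ n₄ j * (e3 - e4)
  eq_u4 n₁ n₂ n₃ n₄ _ := by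
    simp only [fieldFormula, Finset.mul_sum, ← Finset.sum_add_distrib]
    refine Finset.sum_congr rfl fun j _ => ?_
    have ht := term_sub_u4 hq0 hq n₁ n₂ n₃ n₄ j
    have e : q ^ n₁ * q ^ (n₃ - 1) = q ^ (n₁ + n₃ - 1) := by
      rw [← zpow_add₀ hq0]; congr 1; ring
    simp only [coef]
    rw [← mul_assoc, e]
    linear_combination -ht
  eq_c4 n₁ n₂ n₃ n₄ _ := by
    rw [fieldFormula_eq_sum_shift (some Color.u4) _ _ _ (n₄ - 1) (M := n₄) (by omega)]
    simp only [fieldFormula, Finset.mul_sum, ← Finset.sum_add_distrib]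
    refine Finset.sum_congr rfl fun j _ => ?_
    have ht := term_sub_c4 hq0 hq n₁ n₂ n₃ n₄ j
    have e : q ^ n₁ * q ^ (n₄ - 1) = q ^ (n₁ + n₄ - 1) := by
      rw [← zpow_add₀ hq0]; congr 1; ring
    simp only [coef]
    rw [← mul_assoc, e]
    linear_combination -ht
  eq_c3 n₁ n₂ n₃ n₄ _ := by
    simp only [fieldFormula_eq_sum _ (n₁ - 1) _ _ (n₄ - 1) (M := n₄) (by omega)]
    simp only [fieldFormula, Finset.mul_sum, ← Finset.sum_add_distrib, ← Finset.sum_sub_distrib]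
    refine Finset.sum_congr rfl fun j _ => ?_
    have ht := term_sub_c3 hq0 hq n₁ n₂ n₃ n₄ j
    have hr : rho q (n₁ - 1) (n₂ - 1) (n₃ - 1) (n₄ - 1) j = rho q n₁ n₂ n₃ n₄ j := by
      have e : n₁ - n₂ + (n₃ - 1) - (n₄ - 1) + 2 * j =
          n₁ - n₂ + n₃ - n₄ + 2 * j := by ring
      simp [rho, e]
    -- The defining relation of `rho`, multiplied by `term` so that it also holds in the `0 / 0`
    -- case.
    have hrho : (1 - q ^ j - q ^ (n₃ - n₄) * q ^ j + q ^ (n₃ - n₄) * q ^ j * q ^ j) *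
        term q n₁ n₂ n₃ n₄ j = rho q n₁ n₂ n₃ n₄ j *
          (1 - q ^ (n₁ - n₂) * q ^ (n₃ - n₄) * q ^ j * q ^ j) * term q n₁ n₂ n₃ n₄ j := by
      by_cases hN : 0 < n₁ - n₂ + n₃ - n₄ + 2 * j
      · have hN1 : 1 - q ^ (n₁ - n₂ + n₃ - n₄ + 2 * j) ≠ 0 := sub_ne_zero.2 (hq _ hN.ne').symm
        have hr : rho q n₁ n₂ n₃ n₄ j * (1 - q ^ (n₁ - n₂ + n₃ - n₄ + 2 * j)) =
            (1 - q ^ (n₃ - n₄ + j)) * (1 - q ^ j) := div_mul_cancel₀ _ hN1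
        have zA : q ^ (n₃ - n₄ + j) = q ^ (n₃ - n₄) * q ^ j := zpow_add₀ hq0 _ _
        have zN : q ^ (n₁ - n₂ + n₃ - n₄ + 2 * j) =
            q ^ (n₁ - n₂) * q ^ (n₃ - n₄) * q ^ j * q ^ j := by
          simp only [← zpow_add₀ hq0]
          congr 1
          ring
        rw [zA, zN] at hr
        linear_combination (-term q n₁ n₂ n₃ n₄ j) * hr
      · rcases term_eq_zero_or_of_nonpos (q := q) hN with h | ⟨rfl, rfl, rfl⟩
        · simp [h]
        · simp
    have e1 : q ^ n₃ = q ^ n₄ * q ^ (n₃ - n₄) := by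
      rw [← zpow_add₀ hq0]; congr 1; ring
    have e2 : q ^ (n₃ + j) = q ^ n₄ * q ^ (n₃ - n₄) * q ^ j := by
      simp only [← zpow_add₀ hq0]; congr 1; ring
    have e3 : q ^ (n₁ - n₂ + n₃ + j) = q ^ n₄ * q ^ (n₁ - n₂) * q ^ (n₃ - n₄) * q ^ j := by
      simp only [← zpow_add₀ hq0]; congr 1; ring
    have e4 : q ^ (n₄ - 1) = q ^ n₄ * q⁻¹ := zpow_sub_one₀ hq0 _
    have e5 : q ^ (n₃ - 1) = q ^ n₄ * q ^ (n₃ - n₄) * q⁻¹ := by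
      rw [zpow_sub_one₀ hq0, e1]
    have e6 : q ^ (n₃ - 1 + j) = q ^ n₄ * q ^ (n₃ - n₄) * q ^ j * q⁻¹ := by
      rw [← e2, ← zpow_sub_one₀ hq0]; congr 1; ring
    have e7 : q ^ (n₁ - 1 - (n₂ - 1) + (n₃ - 1) + j) =
        q ^ n₄ * q ^ (n₁ - n₂) * q ^ (n₃ - n₄) * q ^ j * q⁻¹ := by
      rw [← e3, ← zpow_sub_one₀ hq0]; congr 1; ring
    have e8 : q ^ (n₁ + n₄ - 1) = q ^ n₁ * q ^ n₄ * q⁻¹ := by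
      rw [zpow_sub_one₀ hq0, zpow_add₀ hq0]
    rw [e8] at ht
    simp only [coef, hr, e1, e2, e3, e4, e5, e6, e7]
    -- Write `d_{u4} + d_{c4} - d_{u3} = q^{n₄} T`; at the lower weight it is `q^{n₄-1} T`. By `ht`
    -- the right side becomes `q^j T` times the summand, and `1 - rho = q^j T` is the relation
    -- `hrho`.
    linear_combination hrho - (1 + q ^ (n₃ - n₄) - q ^ (n₃ - n₄) * q ^ j *
      (1 + q ^ (n₁ - n₂) * rho q n₁ n₂ n₃ n₄ j)) * ht
  eq_c2 n₁ n₂ n₃ n₄ _ := by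
    simp only [fieldFormula_eq_sum_shift _ (n₁ - 1) _ _ (n₄ - 1) (M := n₄) (by omega)]
    simp only [fieldFormula, Finset.mul_sum, ← Finset.sum_add_distrib, ← Finset.sum_sub_distrib]
    refine Finset.sum_congr rfl fun j _ => ?_
    have ht := term_sub_c2 hq0 hq n₁ n₂ n₃ n₄ j
    have e1 : q ^ n₁ = q * q ^ (n₁ - 1) := by rw [← zpow_one_add₀ hq0]; congr 1; ring
    have e2 : q ^ (n₂ - 1) = q * q ^ (n₂ - 2) := by rw [← zpow_one_add₀ hq0]; congr 1; ring
    simp only [coef, e1]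
    rw [e2] at ht
    -- At the lower weight the multiples of `rho` from `c3` and `u2` cancel, and so do those of
    -- `q^{n₁}`, leaving `q^{n₂-1}`.
    linear_combination -ht

end QIdentities

/-! ### The characters as a solution of the system -/

section Characters

/-- The variable `q` in the field of fractions of the ring of power series. -/
def fracX : FractionRing ℚ⟦X⟧ := algebraMap ℚ⟦X⟧ _ X

theorem fracX_ne_zero : fracX ≠ 0 :=
  (map_ne_zero_iff _ (IsFractionRing.injective ℚ⟦X⟧ _)).2 X_ne_zero

theorem fracX_zpow_ne_one (n : ℤ) (hn : n ≠ 0) : fracX ^ n ≠ 1 := by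
  have key : ∀ m : ℕ, m ≠ 0 → fracX ^ m ≠ 1 := by
    intro m hm h
    rw [fracX, ← map_pow, ← map_one (algebraMap ℚ⟦X⟧ (FractionRing ℚ⟦X⟧))] at h
    have h' := congrArg constantCoeff (IsFractionRing.injective ℚ⟦X⟧ _ h)
    simp [hm] at h'
  obtain ⟨m, rfl | rfl⟩ := n.eq_nat_or_neg
  · rw [zpow_natCast]
    exact key m (by omega)
  · rw [zpow_neg, zpow_natCast, Ne, inv_eq_one]
    exact key m (by omega)

theorem algebraMap_X_pow {n : ℤ} (hn : 0 ≤ n) :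
    algebraMap ℚ⟦X⟧ (FractionRing ℚ⟦X⟧) (X ^ n.toNat) = fracX ^ n := by
  rw [map_pow, ← zpow_natCast, Int.toNat_of_nonneg hn]
  rfl

theorem algebraMap_inv {f : ℚ⟦X⟧} (hf : constantCoeff f ≠ 0) :
    algebraMap ℚ⟦X⟧ (FractionRing ℚ⟦X⟧) f⁻¹ = (algebraMap ℚ⟦X⟧ _ f)⁻¹ := by
  refine eq_inv_of_mul_eq_one_left ?_
  rw [← map_mul, PowerSeries.inv_mul_cancel f hf, map_one]

theorem chi_system : CharSystem fracX fun γ n₁ n₂ n₃ n₄ =>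
    algebraMap ℚ⟦X⟧ (FractionRing ℚ⟦X⟧) (chi γ ![n₁, n₂, n₃, n₄]) := by
  have s0 : ∀ n₁ n₂ n₃ n₄ : ℤ, ![n₁, n₂, n₃, n₄] - c2.root =
      ![n₁ - 1, n₂ - 2, n₃ - 1, n₄ - 1] := by intros; simp [root]
  have s1 : ∀ n₁ n₂ n₃ n₄ : ℤ, ![n₁, n₂, n₃, n₄] - c3.root =
      ![n₁ - 1, n₂ - 1, n₃ - 1, n₄ - 1] := by intros; simp [root]
  have s2 : ∀ n₁ n₂ n₃ n₄ : ℤ, ![n₁, n₂, n₃, n₄] - c4.root =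
      ![n₁ - 1, n₂ - 1, n₃, n₄ - 1] := by intros; simp [root]
  have s3 : ∀ n₁ n₂ n₃ n₄ : ℤ, ![n₁, n₂, n₃, n₄] - u4.root =
      ![n₁ - 1, n₂ - 1, n₃ - 1, n₄] := by intros; simp [root]
  have s4 : ∀ n₁ n₂ n₃ n₄ : ℤ, ![n₁, n₂, n₃, n₄] - u3.root =
      ![n₁ - 1, n₂ - 1, n₃, n₄] := by intros; simp [root]
  have s5 : ∀ n₁ n₂ n₃ n₄ : ℤ, ![n₁, n₂, n₃, n₄] - u2.root =
      ![n₁ - 1, n₂, n₃, n₄] := by intros; simp [root]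
  have t1 : allowed (some c2) = Set.univ := by ext b; cases b <;> simp [allowed] <;> decide
  have t2 : allowed (some c2) = insert c2 (allowed (some c3)) := by
    ext b; cases b <;> simp [allowed] <;> decide
  have t2' : ({c2}ᶜ : Set Color) = allowed (some c3) := by
    ext b; cases b <;> simp [allowed] <;> decide
  have t3 : allowed (some c3) = insert c3 (insert c4 (allowed (some u4))) := by
    ext b; cases b <;> simp [allowed] <;> decide
  have t4 : allowed (some c4) = insert c4 (allowed (some u3)) := by
    ext b; cases b <;> simp [allowed] <;> decide
  have t5 : allowed (some u4) = insert u4 (allowed (some u3)) := by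
    ext b; cases b <;> simp [allowed] <;> decide
  have t6 : allowed (some u3) = insert u3 (allowed (some u2)) := by
    ext b; cases b <;> simp [allowed] <;> decide
  have t7 : allowed (some u2) = insert u2 (allowed none) := by
    ext b; cases b <;> simp [allowed] <;> decide
  have r2 : ∀ α, genSeries (starting u2) α =
      X ^ (α 0).toNat * chi none (α - u2.root) := genSeries_starting
    (by simp [allowed]) (by intro b _; cases b <;> decide)
  have r3 : ∀ α, genSeries (starting u3) α =
      X ^ (α 0).toNat * chi (some u2) (α - u3.root) := genSeries_starting
    (by intro b; cases b <;> simp [allowed] <;> decide)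
    (by intro b; cases b <;> simp [allowed] <;> decide)
  have r4 : ∀ α, genSeries (starting u4) α =
      X ^ (α 0).toNat * chi (some c4) (α - u4.root) := genSeries_starting
    (by intro b; cases b <;> simp [allowed] <;> decide)
    (by intro b; cases b <;> simp [allowed] <;> decide)
  have r5 : ∀ α, genSeries (starting c4) α =
      X ^ (α 0).toNat * chi (some u4) (α - c4.root) := genSeries_starting
    (by intro b; cases b <;> simp [allowed] <;> decide)
    (by intro b; cases b <;> simp [allowed] <;> decide)
  have r6 : ∀ α, genSeries (starting c3) α =
      X ^ (α 0).toNat * genSeries (admissible (insert c4 (allowed (some u4)))) (α - c3.root) :=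
    genSeries_starting
    (by intro b; cases b <;> simp [allowed] <;> decide)
    (by intro b; cases b <;> simp [allowed] <;> decide)
  have c7 : ∀ α, chi (some u2) α = chi none α + genSeries (starting u2) α := by
    intro α
    rw [chi, basis, t7, genSeries_insert (by simp [allowed])]
    rfl
  have c6 : ∀ α, chi (some u3) α = chi (some u2) α + genSeries (starting u3) α := by
    intro α
    rw [chi, basis, t6, genSeries_insert (by simp [allowed]; decide)]
    rfl
  have c5 : ∀ α, chi (some u4) α = chi (some u3) α + genSeries (starting u4) α := by
    intro α
    rw [chi, basis, t5, genSeries_insert (by simp [allowed]; decide)]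
    rfl
  have c4' : ∀ α, chi (some c4) α = chi (some u3) α + genSeries (starting c4) α := by
    intro α
    rw [chi, basis, t4, genSeries_insert (by simp [allowed]; decide)]
    rfl
  -- Inclusion-exclusion: the set is the union of `allowed (some u4)` and `allowed (some c4)`, whose
  -- intersection is `allowed (some u3)`.
  have cm : ∀ α, genSeries (admissible (insert c4 (allowed (some u4)))) α =
      chi (some u4) α + chi (some c4) α - chi (some u3) α := by
    intro α
    rw [genSeries_insert (by simp [allowed]; decide), c4' α, chi, basis]
    ring
  have c3' : ∀ α, chi (some c3) α = genSeries (admissible (insert c4 (allowed (some u4)))) α +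
      genSeries (starting c3) α := by
    intro α
    rw [chi, basis, t3, genSeries_insert (by simp [allowed]; decide)]
  have c2' : ∀ α, chi (some c2) α = chi (some c3) α + genSeries (starting c2) α := by
    intro α
    rw [chi, basis, t2, genSeries_insert (by simp [allowed]; decide)]
    rfl
  have hX : ∀ n₁ n₂ n₃ n₄ : ℤ, 0 < n₁ →
      algebraMap ℚ⟦X⟧ (FractionRing ℚ⟦X⟧) (X ^ (![n₁, n₂, n₃, n₄] 0).toNat) = fracX ^ n₁ :=
    fun n₁ _ _ _ h => algebraMap_X_pow h.le
  constructor
  · intro γ n₁ n₂ n₃ n₄ h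
    rw [chi, genSeries_of_neg (by simpa using h), map_zero]
  · intro γ n₂ n₃ n₄
    rw [chi, basis, genSeries_of_zero rfl]
    have : ![0, n₂, n₃, n₄] = 0 ↔ n₂ = 0 ∧ n₃ = 0 ∧ n₄ = 0 := by
      simp
    simp only [this]
    split_ifs <;> simp
  · intro n₁ n₂ n₃ n₄ h
    rw [← hX n₁ n₂ n₃ n₄ h, ← map_mul]
    congr 1
    rw [chi, chi, basis, basis, t1]
    exact genSeries_admissible_empty _
  · intro n₁ n₂ n₃ n₄ h
    rw [← hX n₁ n₂ n₃ n₄ h, ← map_mul, ← map_add, c7, r2, s5]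
  · intro n₁ n₂ n₃ n₄ h
    rw [← hX n₁ n₂ n₃ n₄ h, ← map_mul, ← map_add, c6, r3, s4]
  · intro n₁ n₂ n₃ n₄ h
    rw [← hX n₁ n₂ n₃ n₄ h, ← map_mul, ← map_add, c5, r4, s3]
  · intro n₁ n₂ n₃ n₄ h
    rw [← hX n₁ n₂ n₃ n₄ h, ← map_mul, ← map_add, c4', r5, s2]
  · intro n₁ n₂ n₃ n₄ h
    rw [← hX n₁ n₂ n₃ n₄ h, ← map_add, ← map_sub, ← map_add, ← map_sub, ← map_mul, ← map_add,
      c3', r6, cm, cm, s1]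
  · intro n₁ n₂ n₃ n₄ h
    have e : fracX = algebraMap ℚ⟦X⟧ (FractionRing ℚ⟦X⟧) X := rfl
    -- The tails starting with `x_{u2}(-1)` are counted by `χ_{u2} - χ_0`.
    rw [← hX n₁ n₂ n₃ n₄ h, e, ← map_sub, ← map_mul, ← map_mul, ← map_add, ← map_add,
      c2', genSeries_starting_c2, s0, t2', c7 ![n₁ - 1, n₂ - 2, n₃ - 1, n₄ - 1], add_sub_cancel_left,
      add_assoc]
    rfl

/-! ### Return from the fraction field to power series -/

theorem constantCoeff_qfac (n : ℤ) : constantCoeff (qfac n) = 1 := by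
  simp [qfac]

theorem algebraMap_qpow {n : ℤ} (hn : 0 ≤ n) :
    algebraMap ℚ⟦X⟧ (FractionRing ℚ⟦X⟧) (qpow n) = fracX ^ n :=
  algebraMap_X_pow hn

theorem algebraMap_qfac (n : ℤ) :
    algebraMap ℚ⟦X⟧ (FractionRing ℚ⟦X⟧) (qfac n) = qPoch fracX n := by
  simp only [qfac, qPoch, map_prod, map_sub, map_one, map_pow]
  rfl

theorem algebraMap_summand {n₁ n₂ n₃ n₄ j : ℤ} (h : 0 ≤ f n₁ n₂ n₃ n₄ j)
    (hA : 0 ≤ n₃ - n₄ + j) (hB : 0 ≤ n₁ - n₂ + j) (hj : 0 ≤ j)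
    (hC : 0 ≤ n₁ - n₂ + n₃ - n₄ + j) (hD : 0 ≤ n₄ - j) (hE : 0 ≤ n₂ - n₃ - j) :
    algebraMap ℚ⟦X⟧ (FractionRing ℚ⟦X⟧) (summand n₁ n₂ n₃ n₄ j) =
      term fracX n₁ n₂ n₃ n₄ j := by
  rw [summand, map_mul, map_mul, algebraMap_qpow h, algebraMap_inv (by simp [constantCoeff_qfac])]
  simp only [map_mul, algebraMap_qfac, term, qPochInv_of_nonneg fracX hA,
    qPochInv_of_nonneg fracX hB, qPochInv_of_nonneg fracX hj, qPochInv_of_nonneg fracX hC,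
    qPochInv_of_nonneg fracX hD, qPochInv_of_nonneg fracX hE, mul_inv]

theorem algebraMap_ratio {n₁ n₂ n₃ n₄ j : ℤ} (hA : 0 ≤ n₃ - n₄ + j) (hj : 0 ≤ j)
    (hN : 0 ≤ n₁ - n₂ + n₃ - n₄ + 2 * j) :
    algebraMap ℚ⟦X⟧ (FractionRing ℚ⟦X⟧) (ratio n₁ n₂ n₃ n₄ j) = rho fracX n₁ n₂ n₃ n₄ j := by
  unfold ratio rho
  split_ifs with h
  -- Division by zero in the field agrees with the value 0 chosen in `ratio`.
  · rw [h]
    simp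
  · rw [map_mul, algebraMap_inv, map_mul, map_sub, map_sub, map_sub, map_one, algebraMap_qpow hA,
      algebraMap_qpow hj, algebraMap_qpow hN, div_eq_mul_inv]
    have : (n₁ - n₂ + n₃ - n₄ + 2 * j).toNat ≠ 0 := by omega
    simp [qpow, this]

theorem algebraMap_formula {n₁ n₂ n₃ n₄ : ℤ} (h : Admissible n₁ n₂ n₃ n₄) (γ : Option Color) :
    algebraMap ℚ⟦X⟧ (FractionRing ℚ⟦X⟧) (formula γ n₁ n₂ n₃ n₄) =
      fieldFormula fracX γ n₁ n₂ n₃ n₄ := by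
  obtain ⟨p1, p2, p3, p4, -, hi⟩ := formula_indices_nonneg n₁ n₂ n₃ n₄ h
  have a1 : m' n₁ n₂ n₃ n₄ = max 0 (-(n₁ - n₂)) + max 0 (-(n₃ - n₄)) := by
    unfold m' theta
    split_ifs <;> omega
  have a2 : m'' n₂ n₃ n₄ = max 0 (-(n₂ - n₃ - n₄)) := by
    unfold m'' theta
    split_ifs <;> omega
  have e : fieldFormula fracX γ n₁ n₂ n₃ n₄ =
      ∑ j ∈ Finset.Icc (m' n₁ n₂ n₃ n₄) (n₄ - m'' n₂ n₃ n₄),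
        coef fracX γ n₁ n₂ n₃ n₄ j * term fracX n₁ n₂ n₃ n₄ j := by
    symm
    -- The indices containing `+j` are nonnegative exactly for `j ≥ m'`, since the maximum of `0`,
    -- `n₂ - n₁`, `n₄ - n₃` and the sum of the last two is `m'`. Likewise `n₄ - m''` is the minimum
    -- of `n₄` and `n₂ - n₃`.
    refine Finset.sum_subset (Finset.Icc_subset_Icc (by omega) (by omega)) fun j _ hj => ?_
    by_contra h'
    have := nonneg_of_term_ne_zero (right_ne_zero_of_mul h')
    exact hj (Finset.mem_Icc.2 ⟨by omega, by omega⟩)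
  rw [e, formula, map_sum]
  refine Finset.sum_bij' (fun i _ => i + m' n₁ n₂ n₃ n₄) (fun j _ => j - m' n₁ n₂ n₃ n₄)
    ?_ ?_ (by simp) (by simp) ?_
  · simp only [Finset.mem_Icc]
    omega
  · simp only [Finset.mem_Icc]
    omega
  · intro i hmem
    obtain ⟨b1, b2, b3, b4, b5, b6, b7, b8, b9, b10, -⟩ := hi i hmem _ rfl
    rw [map_mul, algebraMap_summand b1 b3 b4 b5 b6 b7 b8]
    congr 1
    have hr := algebraMap_ratio b3 b5 b2
    rcases γ with _ | γ
    · exact algebraMap_qpow p1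
    · cases γ <;>
        simp only [d, coef, map_add, map_sub, map_mul, map_one, hr, algebraMap_qpow p1,
          algebraMap_qpow p2, algebraMap_qpow p3, algebraMap_qpow p4, algebraMap_qpow b9,
          algebraMap_qpow b10]

theorem chi_eq_formula {n₁ n₂ n₃ n₄ : ℤ} (h : Admissible n₁ n₂ n₃ n₄) (γ : Option Color) :
    chi γ ![n₁, n₂, n₃, n₄] = formula γ n₁ n₂ n₃ n₄ := by
  apply IsFractionRing.injective ℚ⟦X⟧ (FractionRing ℚ⟦X⟧)
  rw [algebraMap_formula h]
  exact chi_system.unique fracX_zpow_ne_one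
    (fieldFormula_system fracX_ne_zero fracX_zpow_ne_one) γ n₁ n₂ n₃ n₄

end Characters

end D4Char

end

theorem mainTheorem3 (n₁ n₂ n₃ n₄ : ℤ) (h : D4Char.Admissible n₁ n₂ n₃ n₄) :
    (∀ γ : Option D4Char.Color,
      D4Char.chi γ ![n₁, n₂, n₃, n₄] = D4Char.formula γ n₁ n₂ n₃ n₄) ∧
    D4Char.chiW .Λ0 ![n₁, n₂, n₃, n₄] = D4Char.formula (some .c2) n₁ n₂ n₃ n₄ ∧
    D4Char.chiW .Λ1 ![n₁, n₂, n₃, n₄] = D4Char.formula none n₁ n₂ n₃ n₄ ∧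
    D4Char.chiW .Λ3 ![n₁, n₂, n₃, n₄] = D4Char.formula (some .c4) n₁ n₂ n₃ n₄ ∧
    D4Char.chiW .Λ4 ![n₁, n₂, n₃, n₄] = D4Char.formula (some .u4) n₁ n₂ n₃ n₄ := by
  have hW : ∀ Λ γ, D4Char.allowedW Λ = D4Char.allowed γ →
      D4Char.chiW Λ ![n₁, n₂, n₃, n₄] = D4Char.formula γ n₁ n₂ n₃ n₄ := by
    intro Λ γ e
    rw [← D4Char.chi_eq_formula h, D4Char.chiW, D4Char.chi, D4Char.basisW, D4Char.basis, e]
  refine ⟨D4Char.chi_eq_formula h, hW _ _ ?_, hW _ _ rfl, hW _ _ rfl, hW _ _ ?_⟩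
  · ext b
    cases b <;> simp [D4Char.allowedW, D4Char.allowed] <;> decide
  · ext b
    cases b <;> simp [D4Char.allowedW, D4Char.allowed] <;> decide
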